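/- **Setting.** Let $n\ge 1$ learners play $T$ rounds. Let $\mathcal X=[0,1]^d$ and let $\mathcal K\subseteq\mathcal X$ be convex with $\|\mathbf x\|\le R$ for all $\mathbf x\in\mathcal K$ (Euclidean norm). Let $\underline{\mathbf x}\in\arg\min_{\mathbf x\in\mathcal K}\|\mathbf x\|_\infty$ and $\alpha=(1-\|\underline{\mathbf x}\|_\infty)/4$. The reward functions $f_t^i$ ($t\in[T]$, $i\in[n]$) are fixed beforehand (oblivious adversary); each is differentiable and non-negative on $\mathcal X$ and continuous DR-submodular: $f(\mathbf x+s\mathbf e_j)-f(\mathbf x)\ge f(\mathbf y+s\mathbf e_j)-f(\mathbf y)$ whenever $\mathbf x\le\mathbf y$, $s\ge 0$ and all four points lie in $\mathcal X$. In round $t$ learner $i$ can query a stochastic gradient $\tilde\nabla f_t^i(\mathbf q)$ at a point $\mathbf q\in\mathcal X$, with $\|\tilde\nabla f_t^i(\mathbf q)\|\le G$ and with conditional expectation $\nabla f_t^i(\mathbf q)$ given everything known to the learner at the time of the query. Put $f_t=\sum_{j=1}^n f_t^j$ and $\mathrm{Reg}(T,i,\alpha)=\alpha\max_{\mathbf x\in\mathcal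 K}\sum_{t=1}^Tf_t(\mathbf x)-\sum_{t=1}^Tf_t(\mathbf x_t^i)$. The matrix $A\in\mathbb R^{n\times n}$ is symmetric, doubly stochastic, positive semidefinite and supported on the edges of the communication graph and the diagonal, and its second largest singular value satisfies $\sigma_2(A)<1$ (with $\sigma_2(A)=0$ if $n=1$). Let $\rho=1-\sigma_2(A)$ and $C=\big\lceil\sqrt2\,\ln(\sqrt{14n})/((\sqrt2-1)\sqrt\rho)\big\rceil$. **The reduction, run with a decentralized online algorithm $\mathcal D$.** In round $t$ learner $i$ gets a preparatory decision $\hat{\mathbf x}_t^i$ from $\mathcal D$, plays $\mathbf x_t^i=(\hat{\mathbf x}_t^i+\underline{\mathbf x})/2$, draws $z_t^i\in[0,1]$, independently of the past, from the distribution with density $(1-u/2)^{-3}/3$, queries the stochastic gradient at $\frac{z_t^i}{2}(\hat{\mathbf x}_t^i-\underline{\mathbf x})+\underline{\mathbf x}$, and sends to $\mathcal D$ the linear loss $\ell_t^i(\mathbf x)=\langle \mathbf c_t^i,\mathbf x\rangle$, where $\mathbf c_t^i$ is $-\frac38$ times the stochastic gradient. **The algorithm $\mathcal D$: the projection-free variant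 of AD-FTRL.** Let $\theta=1/(1+\sqrt{1-\sigma_2(A)^2})$, $L=\max\{\lceil\sqrt T\rceil,C\}$, $h=\sqrt{6LT}\,G/R$, and let $N$ be any integer with $C\le N\le L$. The rounds are divided into consecutive blocks $q=1,2,\dots$ of length $L$ (the last one may be cut off by $T$); $\hat{\mathbf x}_t^i=\mathbf u_q^i$ for all $t$ in block $q$; and $\mathbf g_q^i$ is the sum of $\mathbf c_t^i$ over block $q$. Initially $\mathbf z_1^i=\mathbf z_{1,N-1}^i=\mathbf 0$ and $\mathbf u_1^i=\mathbf u_2^i=\arg\min_{\mathbf x\in\mathcal K}\|\mathbf x\|$. For $q\ge1$ set $\mathbf z_{q+1,0}^i=\mathbf z_q^i+\mathbf g_q^i$, $\mathbf z_{q+1,-1}^i=\mathbf z_{q,N-1}^i+\mathbf g_q^i$, then $\mathbf z_{q+1,k+1}^i=(1+\theta)\sum_{j=1}^nA_{ij}\mathbf z_{q+1,k}^j-\theta\mathbf z_{q+1,k-1}^i$ for $0\le k<N$, and $\mathbf z_{q+1}^i=\mathbf z_{q+1,N}^i$. For $q\ge2$, $\mathbf u_{q+1}^i$ is the result of $L$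 conditional gradient (Frank–Wolfe) steps with exact line search, started at $\mathbf u_q^i$, for minimizing $\langle\mathbf z_{q-1}^i,\mathbf x\rangle+h\|\mathbf x\|^2$ over $\mathcal K$; they use a linear optimization oracle of $\mathcal K$, once per round of block $q$. **Claim.** For every learner $i\in[n]$, $$\mathbb E\big[\mathrm{Reg}(T,i,\alpha)\big]\le 2nGR\sqrt{6TC}+(4\sqrt3+13)\,nGR\,T^{3/4},$$ and the right-hand side is at most $40\,GR\,\big(nT^{3/4}+n\rho^{-1/4}\sqrt{T\ln n}\big)$, hence $O\big(nT^{3/4}+n\rho^{-1/4}\sqrt{T\log n}\big)$. -/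

import Mathlib

open MeasureTheory ProbabilityTheory
open scoped RealInnerProductSpace

noncomputable section

namespace DOCSM

/-- The decision space `ℝ^d` with its Euclidean norm. -/
abbrev Vec (d : ℕ) : Type := EuclideanSpace ℝ (Fin d)

/-! ### Feasible set, decision set and reward functions -/

/-- The feasible set `𝒳 = [0,1]^d`. -/
def cube (d : ℕ) : Set (Vec d) := {x | ∀ k, 0 ≤ x k ∧ x k ≤ 1}

/-- The norm `‖x‖_∞ = max_k |x_k|`. -/
def supNorm {d : ℕ} (x : Vec d) : ℝ := ‖WithLp.ofLp x‖

/-- The decision set is a convex subset of the cube, of radius at most `R`. -/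
structure IsDecisionSet {d : ℕ} (K : Set (Vec d)) (R : ℝ) : Prop where
  subset_cube : K ⊆ cube d
  convex : Convex ℝ K
  norm_le : ∀ x ∈ K, ‖x‖ ≤ R

/-- `x` is a point of `K` at which `N` is smallest (`x ∈ argmin_{y ∈ K} N y`). -/
def IsArgmin {d : ℕ} (N : Vec d → ℝ) (K : Set (Vec d)) (x : Vec d) : Prop :=
  x ∈ K ∧ ∀ y ∈ K, N x ≤ N y

/-- A differentiable, non-negative and continuous DR-submodular function on the cube. -/
structure IsDRReward {d : ℕ} (f : Vec d → ℝ) : Prop where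
  differentiableOn : DifferentiableOn ℝ f (cube d)
  dr : ∀ x ∈ cube d, ∀ y ∈ cube d, (∀ k, x k ≤ y k) → ∀ s : ℝ, 0 ≤ s → ∀ j : Fin d,
    x + s • EuclideanSpace.single j (1 : ℝ) ∈ cube d →
    y + s • EuclideanSpace.single j (1 : ℝ) ∈ cube d →
      f (y + s • EuclideanSpace.single j (1 : ℝ)) - f y ≤
        f (x + s • EuclideanSpace.single j (1 : ℝ)) - f x
  nonneg : ∀ x ∈ cube d, 0 ≤ f x

/-! ### Communication network -/

/-- The second largest singular value `σ₂(A)` (singular values are indexed from `0` in decreasing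
order, with multiplicity; it is `0` for a `1 × 1` matrix). -/
def sigma2 {n : ℕ} (A : Matrix (Fin n) (Fin n) ℝ) : ℝ :=
  (Matrix.toEuclideanLin A).singularValues 1

/-- The communication matrix is supported on the graph, symmetric, doubly stochastic and positive
semidefinite, and its second largest singular value is smaller than one. -/
structure IsCommMatrix {n : ℕ} (𝒢 : SimpleGraph (Fin n)) (A : Matrix (Fin n) (Fin n) ℝ) :
    Prop where
  support : ∀ i j, 0 < A i j → 𝒢.Adj i j ∨ i = j
  symm : A.transpose = A
  doublyStochastic : A ∈ doublyStochastic ℝ (Fin n)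
  posSemidef : A.PosSemidef
  sigma_lt : sigma2 A < 1

/-- The spectral gap `ρ = 1 - σ₂(A)`. -/
def gap {n : ℕ} (A : Matrix (Fin n) (Fin n) ℝ) : ℝ := 1 - sigma2 A

/-- `C = ⌈√2 ln(√(14 n)) / ((√2 - 1) √ρ)⌉`. -/
def commC {n : ℕ} (A : Matrix (Fin n) (Fin n) ℝ) : ℕ :=
  ⌈√2 * Real.log (√(14 * (n : ℝ))) / ((√2 - 1) * √(gap A))⌉₊

/-! ### Randomness: boosting samples and stochastic gradients

Rounds are numbered `0, 1, …, T - 1`. A filtration `ℱ` describes the information produced so far: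
`ℱ t` is everything that has happened before round `t`. -/

/-- The distribution `𝒵` on `[0,1]`, with density `(1 - u/2)⁻³ / 3`. -/
def boostingLaw : Measure ℝ :=
  (volume.restrict (Set.Icc (0 : ℝ) 1)).withDensity
    (fun u => ENNReal.ofReal (1 / (3 * (1 - u / 2) ^ 3)))

/-- What learner `i` knows when it queries its gradient in round `t`: the past and `z_t^i`. -/
abbrev queryInfo {n : ℕ} {Ω : Type*} {mΩ : MeasurableSpace Ω} (ℱ : Filtration ℕ mΩ)
    (z : ℕ → Fin n → Ω → ℝ) (t : ℕ) (i : Fin n) : MeasurableSpace Ω :=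
  ℱ t ⊔ MeasurableSpace.comap (z t i) inferInstance

/-- In every round each learner draws `z_t^i ∼ 𝒵`, independently of the past. -/
structure IsBoostingSample {n : ℕ} {Ω : Type*} {mΩ : MeasurableSpace Ω} (P : Measure Ω)
    (ℱ : Filtration ℕ mΩ) (T : ℕ) (z : ℕ → Fin n → Ω → ℝ) : Prop where
  mem : ∀ t < T, ∀ i ω, z t i ω ∈ Set.Icc (0 : ℝ) 1
  measurable : ∀ t < T, ∀ i, Measurable[ℱ (t + 1)] (z t i)
  law : ∀ t < T, ∀ i, P.map (z t i) = boostingLaw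
  indep : ∀ t < T, ∀ i, Indep (MeasurableSpace.comap (z t i) inferInstance) (ℱ t) P

/-- `sg t i x` is the (random) stochastic gradient of `f t i` at `x ∈ 𝒳`. It is bounded by `G`, and
it is unbiased: `𝔼[sg t i q | information at the time of the query] = ∇ f t i (q)` for every
(random) query point `q ∈ 𝒳` that is chosen on the basis of that information. -/
structure IsStochasticGradient {d n : ℕ} {Ω : Type*} {mΩ : MeasurableSpace Ω} (P : Measure Ω)
    (ℱ : Filtration ℕ mΩ) (T : ℕ) (z : ℕ → Fin n → Ω → ℝ) (f : ℕ → Fin n → Vec d → ℝ) (G : ℝ)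
    (sg : ℕ → Fin n → Vec d → Ω → Vec d) : Prop where
  bounded : ∀ t < T, ∀ i, ∀ x ∈ cube d, ∀ ω, ‖sg t i x ω‖ ≤ G
  measurable : ∀ t < T, ∀ i, ∀ q : Ω → Vec d, Measurable[queryInfo ℱ z t i] q →
    (∀ ω, q ω ∈ cube d) → Measurable[ℱ (t + 1)] (fun ω => sg t i (q ω) ω)
  unbiased : ∀ t < T, ∀ i, ∀ q : Ω → Vec d, Measurable[queryInfo ℱ z t i] q →
    (∀ ω, q ω ∈ cube d) →
      P[fun ω => sg t i (q ω) ω | queryInfo ℱ z t i]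
        =ᵐ[P] fun ω => gradientWithin (f t i) (cube d) (q ω)

/-! ### Decentralized online algorithms on linear losses -/

/-- The linear losses `ℓ_t^i(x) = ⟨c t i, x⟩`, represented by their coefficient vectors. -/
abbrev Losses (d n : ℕ) : Type := ℕ → Fin n → Vec d

/-- A (deterministic) D-OCO algorithm on linear losses: the decisions `x̂_t^1, …, x̂_t^n` of round `t`,
as a function of the losses of the earlier rounds. (When it is run, the sequence that is handed over
at round `t` holds the losses of the rounds before `t`, and `0` from round `t` on.) -/
abbrev DOCOAlg (d n : ℕ) : Type := ℕ → Losses d n → Fin n → Vec d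

/-- A linear optimization oracle over `K`: it returns a point of `argmin_{y ∈ K} ⟨g, y⟩`. -/
def IsLinearOracle {d : ℕ} (K : Set (Vec d)) (lo : Vec d → Vec d) : Prop :=
  ∀ g, lo g ∈ K ∧ ∀ y ∈ K, ⟪g, lo g⟫ ≤ ⟪g, y⟫

/-- The regularized linear objective `⟨z, x⟩ + h ‖x‖²`. -/
def ftrlObj {d : ℕ} (h : ℝ) (z x : Vec d) : ℝ := ⟪z, x⟫ + h * ‖x‖ ^ 2

/-- The gradient `z + 2 h x` of the objective. -/
def ftrlGrad {d : ℕ} (h : ℝ) (z x : Vec d) : Vec d := z + (2 * h) • x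

/-- The exact line search step on the segment from `x` to `v`; see `lineSearch_isMinOn`. -/
def lineSearch {d : ℕ} (h : ℝ) (z x v : Vec d) : ℝ :=
  max 0 (min 1 (-⟪ftrlGrad h z x, v - x⟫ / (2 * h * ‖v - x‖ ^ 2)))

theorem lineSearch_isMinOn {d : ℕ} {h : ℝ} (hh : 0 < h) (z x v : Vec d) :
    lineSearch h z x v ∈ Set.Icc (0 : ℝ) 1 ∧
      IsMinOn (fun s : ℝ => ftrlObj h z (x + s • (v - x))) (Set.Icc 0 1)
        (lineSearch h z x v) := by
  have hexp : ∀ s : ℝ, ftrlObj h z (x + s • (v - x)) =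
      ftrlObj h z x + s * ⟪ftrlGrad h z x, v - x⟫ + h * ‖v - x‖ ^ 2 * s ^ 2 := by
    intro s
    simp only [ftrlObj, ftrlGrad, inner_add_left, inner_add_right, inner_smul_right,
      inner_smul_left, norm_add_sq_real, norm_smul, mul_pow, Real.norm_eq_abs, sq_abs,
      RCLike.conj_to_real]
    ring
  refine ⟨⟨le_max_left _ _, max_le zero_le_one (min_le_left _ _)⟩, ?_⟩
  intro s hs
  obtain ⟨hs0, hs1⟩ := hs
  simp only [Set.mem_ofPred_eq, hexp]
  unfold lineSearch
  by_cases hvx : v - x = 0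
  · simp [hvx]
  have hm : 0 < h * ‖v - x‖ ^ 2 := by positivity
  generalize ⟪ftrlGrad h z x, v - x⟫ = b
  rw [mul_assoc]
  generalize h * ‖v - x‖ ^ 2 = m at hm
  have key : ∀ r : ℝ, 0 ≤ (s - r) * (b + 2 * m * r) →
      ftrlObj h z x + r * b + m * r ^ 2 ≤ ftrlObj h z x + s * b + m * s ^ 2 := by
    intro r hr
    nlinarith [mul_nonneg hm.le (sq_nonneg (s - r))]
  apply key
  rcases le_total (-b / (2 * m)) 0 with h0 | h0
  · rw [max_eq_left (le_trans (min_le_right _ _) h0)]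
    rw [div_le_iff₀ (by linarith)] at h0
    nlinarith
  rcases le_total (-b / (2 * m)) 1 with h1 | h1
  · rw [min_eq_right h1, max_eq_right h0]
    have : b + 2 * m * (-b / (2 * m)) = 0 := by field_simp; ring
    rw [this, mul_zero]
  · rw [min_eq_left h1, max_eq_right zero_le_one]
    rw [le_div_iff₀ (by linarith)] at h1
    nlinarith

/-- One conditional gradient (Frank-Wolfe) step with exact line search. It calls the linear
optimization oracle once. -/
def cgStep {d : ℕ} (lo : Vec d → Vec d) (h : ℝ) (z x : Vec d) : Vec d :=
  x + lineSearch h z x (lo (ftrlGrad h z x)) • (lo (ftrlGrad h z x) - x)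

/-- The accelerated gossip step `(z_k, z_{k-1}) ↦ (z_{k+1}, z_k)`, where
`z_{k+1}^i = (1 + θ) ∑_j A_{ij} z_k^j - θ z_{k-1}^i`. -/
def gossipStep {d n : ℕ} (A : Matrix (Fin n) (Fin n) ℝ) (θ : ℝ)
    (p : (Fin n → Vec d) × (Fin n → Vec d)) : (Fin n → Vec d) × (Fin n → Vec d) :=
  (fun i => (1 + θ) • (∑ j, A i j • p.1 j) - θ • p.2 i, p.1)

/-- The parameters of the projection-free variant of AD-FTRL. -/
structure ADFTRLParams (d n : ℕ) where
  /-- communication matrix -/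
  A : Matrix (Fin n) (Fin n) ℝ
  /-- mixing ratio -/
  θ : ℝ
  /-- number of gossip steps per block -/
  N : ℕ
  /-- block length -/
  L : ℕ
  /-- regularization parameter -/
  h : ℝ
  /-- linear optimization oracle of the decision set -/
  lo : Vec d → Vec d
  /-- initial decision -/
  x₀ : Vec d

namespace ADFTRLParams

variable {d n : ℕ}

/-- The cumulative gradient `g_q^i` of learner `i` over the block `q = 0, 1, …`, which consists of
the rounds `q L, …, q L + L - 1`. -/
def blockGrad (p : ADFTRLParams d n) (c : Losses d n) (q : ℕ) (i : Fin n) : Vec d :=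
  ∑ s ∈ Finset.range p.L, c (q * p.L + s) i

/-- The pair `(z_q, z_{q,N-1})`: both are `0` for the first block, and `N` gossip steps, performed
during block `q + 1`, lead from `(z_q + g_q, z_{q,N-1} + g_q)` to `(z_{q+1}, z_{q+1,N-1})`.
Thus `z_q^i` approximates the network average of the losses of the blocks before `q`. -/
def dual (p : ADFTRLParams d n) (c : Losses d n) : ℕ → (Fin n → Vec d) × (Fin n → Vec d)
  | 0 => (0, 0)
  | q + 1 => (gossipStep p.A p.θ)^[p.N]
      ((dual p c q).1 + blockGrad p c q, (dual p c q).2 + blockGrad p c q)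

/-- The decision of learner `i` in block `q`. The decision for block `q + 2` is obtained by `L`
conditional gradient steps for the objective `⟨z_q^i, x⟩ + h ‖x‖²` from the decision for block
`q + 1`. Both are known when block `q + 1` begins, so that the steps can be spread over the `L`
rounds of that block: one linear optimization per round. -/
def primal (p : ADFTRLParams d n) (c : Losses d n) : ℕ → Fin n → Vec d
  | 0 => fun _ => p.x₀
  | 1 => fun _ => p.x₀
  | q + 2 => fun i => (cgStep p.lo p.h ((dual p c q).1 i))^[p.L] (primal p c (q + 1) i)

/-- The projection-free variant of AD-FTRL: in round `t`, play the decision of its block. -/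
def alg (p : ADFTRLParams d n) : DOCOAlg d n := fun t c i => primal p c (t / p.L) i

end ADFTRLParams

/-! ### The reduction -/

section Reduction

variable {d n : ℕ} {Ω : Type*}

/-- The query point `(z/2)(x̂ - x̲) + x̲`. -/
def queryPoint (xlow : Vec d) (z : ℝ) (x : Vec d) : Vec d := (z / 2) • (x - xlow) + xlow

/-- The losses sent to `D` in the rounds before `t` (and `0` for the later rounds), when the
reduction is run with the D-OCO algorithm `D`: the loss of learner `i` in round `t` is
`x ↦ ⟨-(3/8) sg_t^i(q), x⟩`, where `q` is the query point of the decision `x̂_t^i` of `D`. -/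
def sentLosses (D : DOCOAlg d n) (xlow : Vec d) (z : ℕ → Fin n → Ω → ℝ)
    (sg : ℕ → Fin n → Vec d → Ω → Vec d) (ω : Ω) : ℕ → Losses d n
  | 0 => 0
  | t + 1 => Function.update (sentLosses D xlow z sg ω t) t fun i =>
      -((3 / 8 : ℝ) • sg t i
        (queryPoint xlow (z t i ω) (D t (sentLosses D xlow z sg ω t) i)) ω)

/-- The preparatory decision `x̂_t^i`, obtained from `D`. -/
def prepDecision (D : DOCOAlg d n) (xlow : Vec d) (z : ℕ → Fin n → Ω → ℝ)
    (sg : ℕ → Fin n → Vec d → Ω → Vec d) (t : ℕ) (i : Fin n) (ω : Ω) : Vec d :=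
  D t (sentLosses D xlow z sg ω t) i

/-- The decision `x_t^i = (x̂_t^i + x̲) / 2` played by learner `i` in round `t`. -/
def decision (D : DOCOAlg d n) (xlow : Vec d) (z : ℕ → Fin n → Ω → ℝ)
    (sg : ℕ → Fin n → Vec d → Ω → Vec d) (t : ℕ) (i : Fin n) (ω : Ω) : Vec d :=
  (1 / 2 : ℝ) • (prepDecision D xlow z sg t i ω + xlow)

end Reduction

/-- The `α`-regret `α max_{x ∈ K} ∑_t f_t(x) - ∑_t f_t(x_t)` over the rounds `0, …, T - 1`, where
`f_t = ∑_j f_t^j`, of the decisions `x_t` of one learner. -/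
def regret {d n : ℕ} (K : Set (Vec d)) (f : ℕ → Fin n → Vec d → ℝ) (T : ℕ) (α : ℝ)
    (x : ℕ → Vec d) : ℝ :=
  α * sSup ((fun y => ∑ t ∈ Finset.range T, ∑ j, f t j y) '' K)
    - ∑ t ∈ Finset.range T, ∑ j, f t j (x t)

/-- The tuned parameters of the projection-free AD-FTRL: `θ = 1/(1 + √(1 - σ₂(A)²))`,
`L = max {⌈√T⌉, C}`, `h = √(6 L T) G / R`; the number `N` of gossip steps is left open. -/
def tunedParams {d n : ℕ} (A : Matrix (Fin n) (Fin n) ℝ) (T : ℕ) (G R : ℝ) (N : ℕ)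
    (lo : Vec d → Vec d) (x₀ : Vec d) : ADFTRLParams d n where
  A := A
  θ := 1 / (1 + √(1 - sigma2 A ^ 2))
  N := N
  L := max ⌈√(T : ℝ)⌉₊ (commC A)
  h := √(6 * (max ⌈√(T : ℝ)⌉₊ (commC A) : ℕ) * T) * G / R
  lo := lo
  x₀ := x₀

end DOCSM

end

noncomputable section

namespace DOCSM

/-! ### Convexity, compactness and lattice operations of the cube -/

section Cube

variable {d : ℕ}

/-! The rewards are turned into linear losses in expectation, and the linear problem is then solved
by a deterministic, pathwise argument.

Boosting. A DR-submodular function is concave along directions of constant sign. Together with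
non-negativity this gives `⟪∇f(p), y - p⟫ ≥ (1 - β) f(y) - 2 f(p)` whenever all coordinates of `p`
are at most `β` (`IsDRReward.inner_gradient_ge`). Along the segment of query points, weighted with
the boosting density, the terms in `f(p)` and in the derivative along the segment form a total
derivative. Hence `α f(y) - f((x + xlow)/2)` is at most the mean of `(3/8) ⟪∇f(query), y - x⟫`
(`IsDRReward.le_integral_boostingLaw`). The preparatory decision depends only on the past, the
sample is independent of it, and the stochastic gradient is conditionally unbiased, so the same
holds for the losses actually sent. Learner `i` is charged for every `f_t^j` at its own decision
instead of that of learner `j`; by the gradient bound this costs `(G/2) ‖x̂^i - x̂^j‖`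
(`reward_gap_le`).

Linear losses. The decisions are compared with the exact leaders `v q`, the minimizers of the
regularized network average of the blocks before `q`. Playing `v (q + 1)` in block `q` has regret at
most `n h R²` (`IsFtrlMin.be_the_leader`). Three errors separate the decisions from it, all measured
by strong convexity. The dual variables deviate from the network average by at most one block
gradient (`IsCommMatrix.sum_norm_dual_sub_sq_le`); the conditional gradient steps leave a distance
`4 R / √L`, free of `h`; and the delay amounts to three moves of the leader.
`ADFTRLParams.linear_regret_le` adds these up, and the choice of `L` and `h` balances them.

Gossip. In every eigendirection of `A` the accelerated recursion multiplies a quadratic energy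
exactly by `θ`. After `N ≥ C` steps the factor is at most `1/(14 n)`, small enough to absorb each
newly injected block gradient, so the deviation stays bounded over all blocks. -/

theorem convex_cube : Convex ℝ (cube d) := by
  intro x hx y hy a b ha hb hab k
  have h1 := hx k
  have h2 := hy k
  simp only [PiLp.add_apply, PiLp.smul_apply, smul_eq_mul]
  constructor
  · nlinarith [mul_nonneg ha h1.1, mul_nonneg hb h2.1]
  · nlinarith [mul_le_mul_of_nonneg_left h1.2 ha, mul_le_mul_of_nonneg_left h2.2 hb]

theorem isClosed_cube : IsClosed (cube d) := by
  have : cube d = ⋂ k, {x : Vec d | 0 ≤ x k ∧ x k ≤ 1} := by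
    ext x; simp [cube]
  rw [this]
  refine isClosed_iInter fun k => ?_
  have hc : Continuous fun x : Vec d => x k := by fun_prop
  exact (isClosed_le continuous_const hc).inter (isClosed_le hc continuous_const)

theorem isCompact_cube : IsCompact (cube d) := by
  refine Metric.isCompact_of_isClosed_isBounded isClosed_cube ?_
  refine (Metric.isBounded_iff_subset_closedBall (0 : Vec d)).2 ⟨√(d : ℝ), fun x hx => ?_⟩
  rw [mem_closedBall_zero_iff, EuclideanSpace.norm_eq]
  apply Real.sqrt_le_sqrt
  calc ∑ k, ‖x k‖ ^ 2 ≤ ∑ _k : Fin d, (1 : ℝ) := by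
        refine Finset.sum_le_sum fun k _ => ?_
        rw [Real.norm_eq_abs, sq_abs]
        have := hx k
        nlinarith
    _ = d := by simp

theorem zero_mem_cube : (0 : Vec d) ∈ cube d := fun k => by simp

/-- The coordinatewise maximum. -/
def vecSup (x y : Vec d) : Vec d := WithLp.toLp 2 fun k => max (x k) (y k)

/-- The coordinatewise minimum. -/
def vecInf (x y : Vec d) : Vec d := WithLp.toLp 2 fun k => min (x k) (y k)

theorem vecSup_add_vecInf (x y : Vec d) : vecSup x y + vecInf x y = x + y := by
  ext k
  simp [vecSup, vecInf, max_add_min]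

theorem vecSup_mem_cube {x y : Vec d} (hx : x ∈ cube d) (hy : y ∈ cube d) :
    vecSup x y ∈ cube d := fun k =>
  ⟨(hx k).1.trans (le_max_left _ _), max_le (hx k).2 (hy k).2⟩

theorem vecInf_mem_cube {x y : Vec d} (hx : x ∈ cube d) (hy : y ∈ cube d) :
    vecInf x y ∈ cube d := fun k =>
  ⟨le_min (hx k).1 (hy k).1, (min_le_left _ _).trans (hx k).2⟩

end Cube

/-! ### First-order inequalities for DR-submodular functions -/

namespace IsDRReward

variable {d : ℕ} {f : Vec d → ℝ}

/-- The coordinates of `v` are switched on one at a time, simultaneously at `x` and at `y`. Each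
switch is an instance of the one-coordinate inequality, and the increments add up. -/
theorem dr_add (hf : IsDRReward f) {x y v : Vec d} (hx : x ∈ cube d) (hxy : ∀ k, x k ≤ y k)
    (hv : ∀ k, 0 ≤ v k) (hyv : y + v ∈ cube d) : f (y + v) - f y ≤ f (x + v) - f x := by
  classical
  set w : Finset (Fin d) → Vec d := fun s => WithLp.toLp 2 fun k => if k ∈ s then v k else 0
    with hw
  have hw0 : ∀ s k, 0 ≤ w s k := fun s k => by
    simp only [hw]; split_ifs <;> simp [hv k]
  have hwv : ∀ s k, w s k ≤ v k := fun s k => by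
    simp only [hw]; split_ifs <;> simp [hv k]
  have hyv' : ∀ k, y k + v k ≤ 1 := fun k => (hyv k).2
  have hmy : ∀ s, y + w s ∈ cube d := fun s k => by
    have := hwv s k; have := hw0 s k; have := hyv' k; have := hx k; have := hxy k
    simp only [PiLp.add_apply]
    constructor <;> linarith
  have hmx : ∀ s, x + w s ∈ cube d := fun s k => by
    have := hwv s k; have := hw0 s k; have := hyv' k; have := hx k; have := hxy k
    simp only [PiLp.add_apply]
    constructor <;> linarith
  have hins : ∀ (s : Finset (Fin d)) (j : Fin d), j ∉ s →
      w (insert j s) = w s + v j • EuclideanSpace.single j (1 : ℝ) := by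
    intro s j hj
    ext k
    simp only [hw, Finset.mem_insert, PiLp.add_apply, PiLp.smul_apply, PiLp.single_apply,
      smul_eq_mul]
    by_cases hk : k = j
    · subst hk; simp [hj]
    · simp [hk]
  have key : ∀ s : Finset (Fin d), f (y + w s) - f y ≤ f (x + w s) - f x := by
    intro s
    induction s using Finset.induction_on with
    | empty =>
      have : w ∅ = 0 := by ext k; simp [hw]
      simp [this]
    | insert j s hj ih =>
      have h := hf.dr (x + w s) (hmx s) (y + w s) (hmy s)
        (fun k => by simpa using hxy k) (v j) (hv j) j
        (by rw [add_assoc, ← hins s j hj]; exact hmx _)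
        (by rw [add_assoc, ← hins s j hj]; exact hmy _)
      rw [add_assoc, add_assoc, ← hins s j hj] at h
      linarith
  have hu : w Finset.univ = v := by ext k; simp [hw]
  simpa [hu] using key Finset.univ

/-- Discrete concavity along a non-negative direction: cut the segment into `m` equal steps. The
increments decrease, so their sum lies between `m` times the last and `m` times the first. Letting
`m → ∞` gives the gradient inequalities at the two ends without second derivatives. -/
theorem mul_sub_le_of_nonneg (hf : IsDRReward f) {p v : Vec d} (hp : p ∈ cube d)
    (hv : ∀ k, 0 ≤ v k) (hpv : p + v ∈ cube d) (m : ℕ) (hm : 0 < m) :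
    f (p + v) - f p ≤ m * (f (p + (1 / m : ℝ) • v) - f p) ∧
      m * (f (p + v) - f (p + v - (1 / m : ℝ) • v)) ≤ f (p + v) - f p := by
  have hm' : (0 : ℝ) < m := by exact_mod_cast hm
  set g : ℕ → ℝ := fun k => f (p + ((k : ℝ) / m) • v) with hg
  have hmem : ∀ k : ℕ, k ≤ m → p + ((k : ℝ) / m) • v ∈ cube d := fun k hk => by
    have h1 : (k : ℝ) / m ≤ 1 := (div_le_one hm').2 (by exact_mod_cast hk)
    have h0 : 0 ≤ (k : ℝ) / m := by positivity
    have := convex_cube hp hpv (sub_nonneg.2 h1) h0 (by ring)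
    convert this using 1
    module
  have hstep : ∀ k : ℕ, p + (((k + 1 : ℕ) : ℝ) / m) • v
      = p + ((k : ℝ) / m) • v + (1 / m : ℝ) • v := fun k => by
    push_cast; rw [add_div, add_smul, add_assoc]
  have hsv : ∀ k, 0 ≤ ((1 / m : ℝ) • v) k := fun k => by
    simp only [PiLp.smul_apply, smul_eq_mul]
    exact mul_nonneg (by positivity) (hv k)
  have mono : ∀ j k : ℕ, j ≤ k → k + 1 ≤ m → g (k + 1) - g k ≤ g (j + 1) - g j := by
    intro j k hjk hk
    have := hf.dr_add (x := p + ((j : ℝ) / m) • v) (y := p + ((k : ℝ) / m) • v)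
      (v := (1 / m : ℝ) • v) (hmem j (by omega)) (fun i => by
        simp only [PiLp.add_apply, PiLp.smul_apply, smul_eq_mul]
        gcongr
        exact hv i) hsv
      (by rw [← hstep]; exact hmem _ hk)
    simpa only [hg, hstep] using this
  have htel : f (p + v) - f p = ∑ k ∈ Finset.range m, (g (k + 1) - g k) := by
    rw [Finset.sum_range_sub]
    simp [hg, hm'.ne']
  constructor
  · rw [htel]
    calc _ ≤ ∑ k ∈ Finset.range m, (g (0 + 1) - g 0) := Finset.sum_le_sum fun k hk =>
          mono 0 k (Nat.zero_le _) (Finset.mem_range.1 hk)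
      _ = _ := by simp [hg, mul_sub]
  · rw [htel]
    obtain ⟨k, rfl⟩ : ∃ k, m = k + 1 := ⟨m - 1, by omega⟩
    calc _ = ∑ j ∈ Finset.range (k + 1), (g (k + 1) - g k) := by
          have e1 : p + v = p + (((k + 1 : ℕ) : ℝ) / (k + 1 : ℕ)) • v := by
            rw [div_self hm'.ne', one_smul]
          have e2 : p + v - (1 / ((k + 1 : ℕ) : ℝ)) • v = p + ((k : ℝ) / (k + 1 : ℕ)) • v := by
            conv_lhs => rw [e1, hstep]
            abel
          rw [e2]
          conv_lhs => rw [e1]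
          simp [hg, mul_sub]
      _ ≤ _ := Finset.sum_le_sum fun j hj =>
          mono j k (by have := Finset.mem_range.1 hj; omega) le_rfl

theorem tendsto_mul_sub (hf : DifferentiableOn ℝ f (cube d)) {p v : Vec d} (hp : p ∈ cube d)
    (hpv : p + v ∈ cube d) :
    Filter.Tendsto (fun m : ℕ => (m : ℝ) * (f (p + (1 / m : ℝ) • v) - f p)) Filter.atTop
      (nhds ⟪gradientWithin f (cube d) p, v⟫) := by
  rw [inner_gradientWithin_left]
  have h := (hf p hp).hasFDerivWithinAt
  have hc : Filter.Tendsto (fun n : ℕ => (n : ℝ) • ((1 / n : ℝ) • v)) Filter.atTop (nhds v) := by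
    refine tendsto_const_nhds.congr' ?_
    filter_upwards [Filter.eventually_gt_atTop 0] with n hn
    have : (n : ℝ) ≠ 0 := by exact_mod_cast hn.ne'
    rw [smul_smul, mul_one_div_cancel this, one_smul]
  have h0 : Filter.Tendsto (fun n : ℕ => (1 / n : ℝ) • v) Filter.atTop (nhds 0) := by
    have := (tendsto_one_div_atTop_nhds_zero_nat (𝕜 := ℝ)).smul_const v
    simpa using this
  have hd : ∀ᶠ n : ℕ in Filter.atTop, p + (1 / n : ℝ) • v ∈ cube d := by
    filter_upwards [Filter.eventually_gt_atTop 0] with n hn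
    have hn' : (1 : ℝ) ≤ n := by exact_mod_cast hn
    have := convex_cube hp hpv (a := 1 - 1 / n) (b := 1 / n)
      (sub_nonneg.2 ((div_le_one (by linarith)).2 hn')) (by positivity) (by ring)
    convert this using 1
    module
  have := h.lim (c := fun n : ℕ => (n : ℝ)) (d := fun n : ℕ => (1 / n : ℝ) • v)
    (l := Filter.atTop) h0 hd hc
  simpa using this

theorem sub_le_inner_of_nonneg (hf : IsDRReward f) {p v : Vec d} (hp : p ∈ cube d)
    (hv : ∀ k, 0 ≤ v k) (hpv : p + v ∈ cube d) :
    f (p + v) - f p ≤ ⟪gradientWithin f (cube d) p, v⟫ := by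
  refine ge_of_tendsto (tendsto_mul_sub hf.differentiableOn hp hpv) ?_
  filter_upwards [Filter.eventually_gt_atTop 0] with m hm
  exact (hf.mul_sub_le_of_nonneg hp hv hpv m hm).1

theorem sub_le_inner_of_nonpos (hf : IsDRReward f) {p v : Vec d} (hp : p ∈ cube d)
    (hv : ∀ k, v k ≤ 0) (hpv : p + v ∈ cube d) :
    f (p + v) - f p ≤ ⟪gradientWithin f (cube d) p, v⟫ := by
  refine ge_of_tendsto (tendsto_mul_sub hf.differentiableOn hp hpv) ?_
  filter_upwards [Filter.eventually_gt_atTop 0] with m hm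
  have h := (hf.mul_sub_le_of_nonneg (p := p + v) (v := -v) hpv (fun k => by simpa using hv k)
    (by simpa using hp) m hm).2
  simp only [add_neg_cancel_right, smul_neg, sub_neg_eq_add] at h
  linarith

/-- The ray from `y` through `y ∨ p` can be prolonged by the factor `1 / β` inside the cube. On it
`f` is concave and is non-negative at the far end, so the intermediate value is at least `(1 - β) f
y`. -/
theorem one_sub_mul_le_vecSup (hf : IsDRReward f) {p y : Vec d} (hp : p ∈ cube d)
    (hy : y ∈ cube d) {β : ℝ} (hβ0 : 0 < β) (hβ1 : β ≤ 1) (hpβ : ∀ k, p k ≤ β) :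
    (1 - β) * f y ≤ f (vecSup y p) := by
  set s := vecSup y p with hs
  set w : Vec d := s - y with hw
  have hw0 : ∀ k, 0 ≤ w k := fun k => by simp [hw, hs, vecSup]
  have hsm : s ∈ cube d := vecSup_mem_cube hy hp
  -- With this `r` the far point `s + r • w` is `y + (1 / β) • (s - y)`. It stays in the cube
  -- because `p k - y k ≤ β - y k ≤ β (1 - y k)`.
  set r : ℝ := 1 / β - 1 with hr
  have hr0 : 0 ≤ r := by
    rw [hr, sub_nonneg, le_div_iff₀ hβ0]; linarith
  have hup : s + r • w ∈ cube d := fun k => by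
    have h1 := hy k
    have h2 := hp k
    have h3 := hpβ k
    have hk : (s + r • w) k = y k + (1 / β) * (max (y k) (p k) - y k) := by
      simp only [hw, hs, hr, vecSup, PiLp.add_apply, PiLp.smul_apply, PiLp.sub_apply, smul_eq_mul]
      ring
    rw [hk]
    have hm : 0 ≤ max (y k) (p k) - y k := sub_nonneg.2 (le_max_left _ _)
    refine ⟨add_nonneg h1.1 (by positivity), ?_⟩
    rcases le_total (p k) (y k) with h | h
    · simp [max_eq_left h, h1.2]
    · rw [max_eq_right h]
      have : (1 / β) * (p k - y k) ≤ 1 - y k := by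
        rw [one_div, inv_mul_le_iff₀ hβ0]
        nlinarith
      linarith
  have hfw := hf.sub_le_inner_of_nonneg hsm (v := r • w)
    (fun k => by simpa using mul_nonneg hr0 (hw0 k)) hup
  have hbw := hf.sub_le_inner_of_nonpos hsm (v := -w) (fun k => by simpa using hw0 k)
    (by simpa [hw] using hy)
  have hsy : s + -w = y := by simp [hw]
  rw [hsy, inner_neg_right] at hbw
  rw [inner_smul_right] at hfw
  have hn := hf.nonneg _ hup
  have h1 : r * (f y - f s) ≤ r * (-⟪gradientWithin f (cube d) s, w⟫) :=
    mul_le_mul_of_nonneg_left hbw hr0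
  have h2 : r * f y ≤ (1 / β) * f s := by
    have : (1 / β) * f s = (r + 1) * f s := by rw [hr]; ring
    rw [this]; linarith
  have h3 := mul_le_mul_of_nonneg_left h2 hβ0.le
  have h4 : β * (r * f y) = (1 - β) * f y := by rw [hr]; field_simp
  have h5 : β * (1 / β * f s) = f s := by field_simp
  linarith

/-- Since `y - p = (y ∨ p - p) + (y ∧ p - p)` splits into an upward and a downward direction,
concavity applies to each part. The value at `y ∧ p` is dropped by non-negativity. -/
theorem inner_gradient_ge (hf : IsDRReward f) {p y : Vec d} (hp : p ∈ cube d)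
    (hy : y ∈ cube d) {β : ℝ} (hβ0 : 0 < β) (hβ1 : β ≤ 1) (hpβ : ∀ k, p k ≤ β) :
    (1 - β) * f y - 2 * f p ≤ ⟪gradientWithin f (cube d) p, y - p⟫ := by
  have h1 := hf.sub_le_inner_of_nonneg hp (v := vecSup y p - p)
    (fun k => by simp [vecSup]) (by simpa using vecSup_mem_cube hy hp)
  have h2 := hf.sub_le_inner_of_nonpos hp (v := vecInf y p - p)
    (fun k => by simp [vecInf]) (by simpa using vecInf_mem_cube hy hp)
  have h3 := hf.one_sub_mul_le_vecSup hp hy hβ0 hβ1 hpβ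
  have h4 := hf.nonneg _ (vecInf_mem_cube hy hp)
  have e : y - p = (vecSup y p - p) + (vecInf y p - p) := by
    have := vecSup_add_vecInf y p
    rw [sub_add_sub_comm, this]; abel
  rw [e, inner_add_right]
  rw [add_sub_cancel] at h1 h2
  linarith

end IsDRReward

/-! ### The boosted gradient inequality -/

section Boosting

variable {d : ℕ}

theorem supNorm_nonneg (x : Vec d) : 0 ≤ supNorm x := norm_nonneg _

theorem abs_le_supNorm (x : Vec d) (k : Fin d) : |x k| ≤ supNorm x :=
  norm_le_pi_norm (WithLp.ofLp x) k

theorem supNorm_le_one {x : Vec d} (hx : x ∈ cube d) : supNorm x ≤ 1 := by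
  refine (pi_norm_le_iff_of_nonneg zero_le_one).2 fun k => ?_
  rw [Real.norm_eq_abs, abs_of_nonneg (hx k).1]
  exact (hx k).2

theorem queryPoint_mem {K : Set (Vec d)} (hK : Convex ℝ K) {xlow x : Vec d} (hl : xlow ∈ K)
    (hx : x ∈ K) {u : ℝ} (hu : u ∈ Set.Icc (0 : ℝ) 1) : queryPoint xlow u x ∈ K := by
  have := hK hl hx (a := 1 - u / 2) (b := u / 2) (by linarith [hu.2]) (by linarith [hu.1])
    (by ring)
  convert this using 1
  unfold queryPoint
  module

theorem queryPoint_one (xlow x : Vec d) : queryPoint xlow 1 x = (1 / 2 : ℝ) • (x + xlow) := by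
  unfold queryPoint
  module

theorem hasDerivAt_queryPoint (xlow x : Vec d) (u : ℝ) :
    HasDerivAt (fun u => queryPoint xlow u x) ((1 / 2 : ℝ) • (x - xlow)) u := by
  unfold queryPoint
  exact (((hasDerivAt_id u).div_const 2).smul_const (x - xlow)).add_const xlow

theorem measurable_boostingDensity :
    Measurable fun u : ℝ => ENNReal.ofReal (1 / (3 * (1 - u / 2) ^ 3)) := by fun_prop

theorem integral_boostingLaw (φ : ℝ → ℝ) :
    ∫ u, φ u ∂boostingLaw = ∫ u in (0 : ℝ)..1, 1 / (3 * (1 - u / 2) ^ 3) * φ u := by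
  rw [boostingLaw, integral_withDensity_eq_integral_toReal_smul
    measurable_boostingDensity (by simp), intervalIntegral.integral_of_le zero_le_one,
    ← integral_Icc_eq_integral_Ioc]
  refine setIntegral_congr_fun measurableSet_Icc fun u hu => ?_
  have : 0 ≤ 1 / (3 * (1 - u / 2) ^ 3) := by
    have : 0 ≤ 1 - u / 2 := by linarith [hu.2]
    positivity
  simp only [ENNReal.toReal_ofReal this, smul_eq_mul]

theorem integrable_boostingLaw_iff (φ : ℝ → ℝ) :
    Integrable φ boostingLaw ↔
      IntegrableOn (fun u => 1 / (3 * (1 - u / 2) ^ 3) * φ u) (Set.Icc 0 1) := by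
  rw [boostingLaw, integrable_withDensity_iff_integrable_smul'
    measurable_boostingDensity (by simp)]
  refine integrableOn_congr_fun (fun u hu => ?_) measurableSet_Icc
  have : 0 ≤ 1 / (3 * (1 - u / 2) ^ 3) := by
    have : 0 ≤ 1 - u / 2 := by linarith [hu.2]
    positivity
  simp only [ENNReal.toReal_ofReal this, smul_eq_mul]

/-- The boosting density times `3/8` is `1 / (8 r³)` with `r = 1 - u / 2`. This weight makes the
pointwise lower bound of the integrand the derivative of an explicit function, whose boundary values
give the left side plus `f xlow / 4 ≥ 0`. -/
theorem IsDRReward.le_integral_boostingLaw {f : Vec d → ℝ} (hf : IsDRReward f)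
    {xlow x y : Vec d} (hl : xlow ∈ cube d) (hx : x ∈ cube d) (hy : y ∈ cube d)
    (hint : Integrable (fun u => (3 / 8 : ℝ) *
      ⟪gradientWithin f (cube d) (queryPoint xlow u x), y - x⟫) boostingLaw) :
    (1 - supNorm xlow) / 4 * f y - f ((1 / 2 : ℝ) • (x + xlow)) ≤
      ∫ u, (3 / 8 : ℝ) * ⟪gradientWithin f (cube d) (queryPoint xlow u x), y - x⟫
        ∂boostingLaw := by
  rw [integral_boostingLaw]
  rw [integrable_boostingLaw_iff] at hint
  set b := supNorm xlow with hb
  have hb0 : 0 ≤ b := supNorm_nonneg _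
  have hb1 : b ≤ 1 := supNorm_le_one hl
  set g : ℝ → ℝ := fun u => f (queryPoint xlow u x) with hg
  set g' : ℝ → ℝ := fun u =>
    ⟪gradientWithin f (cube d) (queryPoint xlow u x), (1 / 2 : ℝ) • (x - xlow)⟫ with hg'
  have hmem : ∀ u ∈ Set.Icc (0 : ℝ) 1, queryPoint xlow u x ∈ cube d := fun u hu =>
    queryPoint_mem convex_cube hl hx hu
  have hgd : ∀ u ∈ Set.Icc (0 : ℝ) 1, HasDerivWithinAt g (g' u) (Set.Icc 0 1) u := by
    intro u hu
    simp only [hg', inner_gradientWithin_left]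
    exact (hf.differentiableOn _ (hmem u hu)).hasFDerivWithinAt.comp_hasDerivWithinAt u
      (hasDerivAt_queryPoint xlow x u).hasDerivWithinAt hmem
  -- The increment of `Φ` over `[0, 1]` is `(1 - b) / 4 * f y - g 1 + g 0 / 4`.
  set Φ : ℝ → ℝ := fun u => (1 / 4) * (1 - b) * f y * (1 - u / 2)⁻¹
    - (1 / 4) * (((1 - u / 2)⁻¹) ^ 2 * g u) with hΦ
  set Φ' : ℝ → ℝ := fun u => (1 / 4) * (1 - b) * f y * (1 / 2 * ((1 - u / 2)⁻¹) ^ 2)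
    - (1 / 4) * (((1 - u / 2)⁻¹) ^ 3 * g u + ((1 - u / 2)⁻¹) ^ 2 * g' u) with hΦ'
  have hΦd : ∀ u ∈ Set.Icc (0 : ℝ) 1, HasDerivWithinAt Φ (Φ' u) (Set.Icc 0 1) u := by
    intro u hu
    have hr : 1 - u / 2 ≠ 0 := by have := hu.2; linarith
    have h1 : HasDerivWithinAt (fun u : ℝ => 1 - u / 2) (-(1 / 2)) (Set.Icc 0 1) u :=
      (((hasDerivAt_id u).div_const 2).const_sub 1).hasDerivWithinAt
    have h2 := h1.inv hr
    have h3 := (h2.const_mul ((1 / 4) * (1 - b) * f y)).sub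
      (((h2.pow 2).mul (hgd u hu)).const_mul (1 / 4))
    refine (h3.congr_deriv ?_)
    simp only [hΦ', Pi.pow_apply, Pi.inv_apply, Nat.reduceSub, pow_one]
    generalize 1 - u / 2 = r at hr ⊢
    field_simp
    push_cast
    ring
  -- The gradient need not be continuous. This one-sided form of the fundamental theorem only needs
  -- an integrable majorant of `Φ'`, on the open interval.
  have hmain := intervalIntegral.sub_le_integral_of_hasDeriv_right_of_le (zero_le_one (α := ℝ))
    (fun u hu => (hΦd u hu).continuousWithinAt)
    (fun u hu => ((hΦd u ⟨hu.1.le, hu.2.le⟩).hasDerivAt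
      (Icc_mem_nhds hu.1 hu.2)).hasDerivWithinAt) hint ?_
  · refine le_trans ?_ hmain
    have hg1 : g 1 = f ((1 / 2 : ℝ) • (x + xlow)) := by simp only [hg, queryPoint_one]
    have hg0 : 0 ≤ g 0 := hf.nonneg _ (hmem 0 (by simp))
    simp only [hΦ, hg1]
    norm_num
    linarith
  · intro u hu
    have hr : 0 < 1 - u / 2 := by have := hu.2; linarith
    set r := 1 - u / 2 with hr'
    have hu' : u ∈ Set.Icc (0 : ℝ) 1 := ⟨hu.1.le, hu.2.le⟩
    have hr1 : r < 1 := by rw [hr']; linarith [hu.1]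
    -- The query point is `r • xlow + (1 - r) • x`, with coordinates at most `r b + (1 - r)`.
    -- Positivity of this `β` uses `r < 1`, that is `u > 0`.
    have hge := hf.inner_gradient_ge (hmem u hu') hy (β := 1 - r * (1 - b))
      (by nlinarith) (by nlinarith) (fun k => by
        have h1 := (le_abs_self _).trans (abs_le_supNorm xlow k)
        have h2 := (hx k).2
        have h3 : queryPoint xlow u x k = (1 - u / 2) * xlow k + u / 2 * x k := by
          simp only [queryPoint, PiLp.add_apply, PiLp.smul_apply, PiLp.sub_apply, smul_eq_mul]
          ring
        rw [h3, ← hr']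
        have h4 : r * xlow k ≤ r * b := mul_le_mul_of_nonneg_left h1 hr.le
        have h5 : u / 2 * x k ≤ u / 2 := by nlinarith [hu.1]
        have h6 : u / 2 = 1 - r := by rw [hr']; ring
        rw [h6] at h5 ⊢
        linarith)
    have hsplit : ⟪gradientWithin f (cube d) (queryPoint xlow u x), y - x⟫
        = ⟪gradientWithin f (cube d) (queryPoint xlow u x), y - queryPoint xlow u x⟫
          - 2 * r * g' u := by
      have : y - x = (y - queryPoint xlow u x) - (2 * r) • ((1 / 2 : ℝ) • (x - xlow)) := by
        rw [hr']; unfold queryPoint; module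
      rw [this, inner_sub_right, inner_smul_right _ _ (2 * r)]
    rw [hsplit]
    generalize ⟪gradientWithin f (cube d) (queryPoint xlow u x), y - queryPoint xlow u x⟫ = I
      at hge
    have hpos : 0 ≤ 1 / (8 * r ^ 3) := by positivity
    have := mul_le_mul_of_nonneg_left hge hpos
    have e1 : Φ' u = 1 / (8 * r ^ 3) * ((1 - (1 - r * (1 - b))) * f y
        - 2 * f (queryPoint xlow u x)) - 1 / (8 * r ^ 3) * (2 * r * g' u) := by
      simp only [hΦ', ← hr', hg]
      field_simp
      ring
    have e2 : 1 / (3 * r ^ 3) * (3 / 8 * (I - 2 * r * g' u))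
        = 1 / (8 * r ^ 3) * I - 1 / (8 * r ^ 3) * (2 * r * g' u) := by
      field_simp
    rw [e1, e2]
    linarith

end Boosting

/-! ### Regularized leaders and conditional gradient steps -/

section FTRL

variable {d : ℕ}

/-- First-order optimality of `v` for the objective `⟨z, x⟩ + h ‖x‖²` over `S`. -/
def IsFtrlMin (S : Set (Vec d)) (h : ℝ) (z v : Vec d) : Prop :=
  v ∈ S ∧ ∀ w ∈ S, 0 ≤ ⟪ftrlGrad h z v, w - v⟫

theorem ftrlObj_eq (h : ℝ) (z v w : Vec d) :
    ftrlObj h z w = ftrlObj h z v + ⟪ftrlGrad h z v, w - v⟫ + h * ‖w - v‖ ^ 2 := by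
  simp only [ftrlObj, ftrlGrad, inner_add_left, inner_sub_right, inner_smul_left,
    norm_sub_sq_real, RCLike.conj_to_real, real_inner_self_eq_norm_sq, real_inner_comm v w]
  ring

/-- Completing the square turns the minimizer into the projection of `-z / (2 h)`. A closed set is
needed; as `K` itself need not be closed, exact leaders are later taken in `closure K`. -/
theorem exists_isFtrlMin {S : Set (Vec d)} (hS : IsClosed S) (hc : Convex ℝ S)
    (hne : S.Nonempty) {h : ℝ} (hh : 0 < h) (z : Vec d) : ∃ v, IsFtrlMin S h z v := by
  obtain ⟨v, hv, hmin⟩ := exists_norm_eq_iInf_of_complete_convex hne hS.isComplete hc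
    ((-(1 / (2 * h))) • z)
  rw [norm_eq_iInf_iff_real_inner_le_zero hc hv] at hmin
  refine ⟨v, hv, fun w hw => ?_⟩
  have h1 := hmin w hw
  have h2 : ftrlGrad h z v = (-(2 * h)) • ((-(1 / (2 * h))) • z - v) := by
    rw [ftrlGrad, smul_sub, smul_smul]
    have : -(2 * h) * -(1 / (2 * h)) = 1 := by field_simp
    rw [this]
    module
  rw [h2, real_inner_smul_left]
  nlinarith

namespace IsFtrlMin

variable {S : Set (Vec d)} {h : ℝ}

theorem obj_add_le {z v w : Vec d} (hv : IsFtrlMin S h z v) (hw : w ∈ S) :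
    ftrlObj h z v + h * ‖w - v‖ ^ 2 ≤ ftrlObj h z w := by
  rw [ftrlObj_eq h z v w]
  linarith [hv.2 w hw]

/-- Adding the two variational inequalities, each tested at the other minimizer, gives `2 h ‖v -
v'‖² ≤ ⟪z - z', v' - v⟫`. -/
theorem norm_sub_le (hh : 0 < h) {z z' v v' : Vec d} (hv : IsFtrlMin S h z v)
    (hv' : IsFtrlMin S h z' v') : ‖v - v'‖ ≤ ‖z - z'‖ / (2 * h) := by
  have h1 := hv.2 v' hv'.1
  have h2 := hv'.2 v hv.1
  have h3 : 2 * h * ‖v - v'‖ ^ 2 ≤ ⟪z - z', v' - v⟫ := by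
    rw [← real_inner_self_eq_norm_sq]
    have e : ⟪ftrlGrad h z v, v' - v⟫ + ⟪ftrlGrad h z' v', v - v'⟫
        = ⟪z - z', v' - v⟫ - 2 * h * ⟪v - v', v - v'⟫ := by
      simp only [ftrlGrad, inner_add_left, inner_sub_right, inner_sub_left, inner_smul_left,
        RCLike.conj_to_real]
      ring
    linarith
  have h4 := (real_inner_le_norm (z - z') (v' - v))
  rw [norm_sub_rev v' v] at h4
  rw [le_div_iff₀ (by positivity)]
  rcases (norm_nonneg (v - v')).eq_or_lt with h0 | h0
  · rw [← h0]; simp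
  · have : (2 * h * ‖v - v'‖) * ‖v - v'‖ ≤ ‖z - z'‖ * ‖v - v'‖ := by nlinarith
    have := le_of_mul_le_mul_right this h0
    linarith

/-- Identifies the leader before any loss with the initial decision, by strict convexity; this
covers the first two blocks. -/
theorem eq_of_isArgmin {x₀ v : Vec d} {K : Set (Vec d)} (hh : 0 < h)
    (hx₀ : IsArgmin (fun x => ‖x‖) K x₀) (hv : IsFtrlMin (closure K) h 0 v) : v = x₀ := by
  have h1 := hv.obj_add_le (subset_closure hx₀.1)
  have h2 : ‖x₀‖ ≤ ‖v‖ := by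
    have hcl : IsClosed {y : Vec d | ‖x₀‖ ≤ ‖y‖} := isClosed_le continuous_const continuous_norm
    exact closure_minimal (fun y hy => hx₀.2 y hy) hcl hv.1
  simp only [ftrlObj, inner_zero_left, zero_add] at h1
  have h3 : ‖x₀‖ ^ 2 ≤ ‖v‖ ^ 2 := by gcongr
  have h4 : h * ‖x₀ - v‖ ^ 2 ≤ 0 := by nlinarith
  have h5 : ‖x₀ - v‖ ^ 2 ≤ 0 := by
    by_contra hc
    push Not at hc
    nlinarith [mul_pos hh hc]
  have h6 : ‖x₀ - v‖ = 0 := by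
    have := norm_nonneg (x₀ - v)
    nlinarith
  exact (sub_eq_zero.1 (norm_eq_zero.1 h6)).symm

/-- By induction, the losses at the one-step-ahead leaders total at most the minimal regularized
objective, which is at most its value at `y`. -/
theorem be_the_leader (hh : 0 ≤ h) (γ x : ℕ → Vec d)
    (hx : ∀ q, IsFtrlMin S h (∑ s ∈ Finset.range q, γ s) (x q)) (Q : ℕ) {y : Vec d} (hy : y ∈ S) :
    ∑ q ∈ Finset.range Q, ⟪γ q, x (q + 1) - y⟫ ≤ h * ‖y‖ ^ 2 := by
  have hind : ∀ Q, ∑ q ∈ Finset.range Q, ⟪γ q, x (q + 1)⟫ ≤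
      ftrlObj h (∑ s ∈ Finset.range Q, γ s) (x Q) := by
    intro Q
    induction Q with
    | zero => simp only [Finset.range_zero, Finset.sum_empty, ftrlObj, inner_zero_left]; positivity
    | succ Q ih =>
      rw [Finset.sum_range_succ, Finset.sum_range_succ _ Q]
      have h1 := (hx Q).obj_add_le (hx (Q + 1)).1
      have h2 : 0 ≤ h * ‖x (Q + 1) - x Q‖ ^ 2 := by positivity
      simp only [ftrlObj, inner_add_left] at h1 ih ⊢
      linarith
  have h1 := (hx Q).obj_add_le hy
  have h2 : 0 ≤ h * ‖y - x Q‖ ^ 2 := by positivity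
  have h3 := hind Q
  simp only [inner_sub_right, Finset.sum_sub_distrib, ← sum_inner]
  simp only [ftrlObj] at h1 h3
  linarith

end IsFtrlMin

theorem lineSearch_mem (h : ℝ) (z x v : Vec d) : lineSearch h z x v ∈ Set.Icc (0 : ℝ) 1 :=
  ⟨le_max_left _ _, max_le zero_le_one (min_le_left _ _)⟩

theorem add_smul_sub_mem {K : Set (Vec d)} (hK : Convex ℝ K) {x v : Vec d} (hx : x ∈ K)
    (hv : v ∈ K) {s : ℝ} (hs : s ∈ Set.Icc (0 : ℝ) 1) : x + s • (v - x) ∈ K := by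
  have := hK hx hv (sub_nonneg.2 hs.2) hs.1 (by ring)
  convert this using 1
  module

theorem cgStep_mem {K : Set (Vec d)} (hK : Convex ℝ K) {lo : Vec d → Vec d}
    (hlo : IsLinearOracle K lo) (h : ℝ) (z : Vec d) {x : Vec d} (hx : x ∈ K) :
    cgStep lo h z x ∈ K :=
  add_smul_sub_mem hK hx (hlo _).1 (lineSearch_mem _ _ _ _)

theorem cgStep_iterate_mem {K : Set (Vec d)} (hK : Convex ℝ K) {lo : Vec d → Vec d}
    (hlo : IsLinearOracle K lo) (h : ℝ) (z : Vec d) {x : Vec d} (hx : x ∈ K) (k : ℕ) :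
    (cgStep lo h z)^[k] x ∈ K := by
  induction k with
  | zero => exact hx
  | succ k ih => rw [Function.iterate_succ_apply']; exact cgStep_mem hK hlo h z ih

/-- Exact line search does at least as well as any fixed step `s`, and the objective is exactly
quadratic along the segment, with diameter at most `2 R`. The oracle's optimality passes to `closure
K` by continuity. -/
theorem cgStep_obj_sub_le {K : Set (Vec d)} {R h : ℝ} (hK : IsDecisionSet K R) (hh : 0 < h)
    {lo : Vec d → Vec d} (hlo : IsLinearOracle K lo) {z x v : Vec d} (hx : x ∈ K)
    (hv : v ∈ closure K) {s : ℝ} (hs : s ∈ Set.Icc (0 : ℝ) 1) :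
    ftrlObj h z (cgStep lo h z x) - ftrlObj h z v ≤
      (1 - s) * (ftrlObj h z x - ftrlObj h z v) + 4 * h * R ^ 2 * s ^ 2 := by
  set g := ftrlGrad h z x with hg
  have h1 : ftrlObj h z (cgStep lo h z x) ≤ ftrlObj h z (x + s • (lo g - x)) :=
    (lineSearch_isMinOn hh z x (lo g)).2 hs
  have h2 := ftrlObj_eq h z x (x + s • (lo g - x))
  have h3 : ⟪g, lo g⟫ ≤ ⟪g, v⟫ := by
    have hcl : IsClosed {y : Vec d | ⟪g, lo g⟫ ≤ ⟪g, y⟫} :=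
      isClosed_le continuous_const (continuous_const.inner continuous_id)
    exact closure_minimal (fun y hy => (hlo g).2 y hy) hcl hv
  have h4 := ftrlObj_eq h z x v
  rw [add_sub_cancel_left, norm_smul, Real.norm_eq_abs, mul_pow, sq_abs, ← hg,
    inner_smul_right] at h2
  rw [← hg] at h4
  have h5 : ‖lo g - x‖ ≤ 2 * R := by
    calc ‖lo g - x‖ ≤ ‖lo g‖ + ‖x‖ := norm_sub_le _ _
      _ ≤ 2 * R := by linarith [hK.norm_le _ (hlo g).1, hK.norm_le _ hx]
  have h6 : ‖lo g - x‖ ^ 2 ≤ 4 * R ^ 2 := by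
    calc ‖lo g - x‖ ^ 2 ≤ (2 * R) ^ 2 := by gcongr
      _ = _ := by ring
  have h7 : h * (s ^ 2 * ‖lo g - x‖ ^ 2) ≤ h * (s ^ 2 * (4 * R ^ 2)) := by gcongr
  have h8 : 0 ≤ h * ‖v - x‖ ^ 2 := by positivity
  have h9 : ⟪g, lo g - x⟫ ≤ ftrlObj h z v - ftrlObj h z x := by
    rw [inner_sub_right] at h4 ⊢
    linarith
  have h10 := mul_le_mul_of_nonneg_left h9 hs.1
  nlinarith

theorem cgStep_iterate_obj_sub_le {K : Set (Vec d)} {R h : ℝ} (hK : IsDecisionSet K R)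
    (hh : 0 < h) {lo : Vec d → Vec d} (hlo : IsLinearOracle K lo) {z x v : Vec d} (hx : x ∈ K)
    (hv : v ∈ closure K) (k : ℕ) :
    ftrlObj h z ((cgStep lo h z)^[k + 1] x) - ftrlObj h z v ≤ 16 * h * R ^ 2 / (k + 3) := by
  have hc : 0 ≤ h * R ^ 2 := by positivity
  induction k with
  | zero =>
    -- The comparison step `s = 1` erases the initial gap, so the bound does not depend on the
    -- starting point.
    have := cgStep_obj_sub_le hK hh hlo (z := z) hx hv (s := 1) (by simp)
    simp only [zero_add, Function.iterate_one, Nat.cast_zero]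
    linarith
  | succ k ih =>
    rw [Function.iterate_succ_apply']
    have hk : (0 : ℝ) ≤ k := Nat.cast_nonneg k
    have hs : 2 / ((k : ℝ) + 3) ∈ Set.Icc (0 : ℝ) 1 :=
      ⟨by positivity, by rw [div_le_one (by positivity)]; linarith⟩
    have h1 := cgStep_obj_sub_le hK hh hlo (z := z)
      (cgStep_iterate_mem hK.convex hlo h z hx (k + 1)) hv hs
    have h2 := mul_le_mul_of_nonneg_left ih (sub_nonneg.2 hs.2)
    have h3 : (1 - 2 / ((k : ℝ) + 3)) * (16 * h * R ^ 2 / (k + 3))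
        + 4 * h * R ^ 2 * (2 / ((k : ℝ) + 3)) ^ 2 ≤ 16 * h * R ^ 2 / ((k + 1 : ℕ) + 3) := by
      have e : (1 - 2 / ((k : ℝ) + 3)) * (16 * h * R ^ 2 / (k + 3))
        + 4 * h * R ^ 2 * (2 / ((k : ℝ) + 3)) ^ 2
        = 16 * (h * R ^ 2) * ((k + 2) / (k + 3) ^ 2) := by
        field_simp; ring
      have e2 : 16 * h * R ^ 2 / ((k + 1 : ℕ) + 3) = 16 * (h * R ^ 2) * (1 / (k + 4)) := by
        push_cast
        field_simp
        ring
      rw [e, e2]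
      refine mul_le_mul_of_nonneg_left ?_ (by positivity)
      rw [div_le_div_iff₀ (by positivity) (by positivity)]
      nlinarith
    linarith

/-- Strong convexity converts the objective gap into a distance. Both scale with `h`, which cancels.
-/
theorem norm_cgStep_iterate_sub_le {K : Set (Vec d)} {R h : ℝ} (hK : IsDecisionSet K R)
    (hR : 0 ≤ R) (hh : 0 < h) {lo : Vec d → Vec d} (hlo : IsLinearOracle K lo) {z x v : Vec d}
    (hx : x ∈ K) (hv : IsFtrlMin (closure K) h z v) {L : ℕ} (hL : 0 < L) :
    ‖(cgStep lo h z)^[L] x - v‖ ≤ 4 * R / √L := by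
  obtain ⟨k, rfl⟩ : ∃ k, L = k + 1 := ⟨L - 1, by omega⟩
  have h1 := cgStep_iterate_obj_sub_le hK hh hlo (z := z) hx hv.1 k
  have h2 := hv.obj_add_le (subset_closure (cgStep_iterate_mem hK.convex hlo h z hx (k + 1)))
  set D := ‖(cgStep lo h z)^[k + 1] x - v‖
  have h3 : h * D ^ 2 ≤ h * (16 * R ^ 2 / ((k + 1 : ℕ) : ℝ)) := by
    calc h * D ^ 2 ≤ 16 * h * R ^ 2 / (k + 3) := by linarith
      _ ≤ 16 * h * R ^ 2 / ((k + 1 : ℕ) : ℝ) := by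
        push_cast
        gcongr
        norm_num
      _ = _ := by ring
  have h4 := le_of_mul_le_mul_left h3 hh
  refine abs_le_of_sq_le_sq' ?_ (by positivity) |>.2
  rw [div_pow, Real.sq_sqrt (by positivity)]
  convert h4 using 2
  ring

end FTRL

/-! ### Second singular value as a bound on eigenvalues -/

section SingularValue

variable {E : Type*} [NormedAddCommGroup E] [InnerProductSpace ℝ E] [FiniteDimensional ℝ E]

theorem norm_sq_apply_eq_sum (T : E →ₗ[ℝ] E) {n : ℕ} (hn : Module.finrank ℝ E = n) (w : E) :
    ‖T w‖ ^ 2 = ∑ i, T.isSymmetric_adjoint_comp_self.eigenvalues hn i *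
      ⟪T.isSymmetric_adjoint_comp_self.eigenvectorBasis hn i, w⟫ ^ 2 := by
  set hS := T.isSymmetric_adjoint_comp_self
  have h1 : ‖T w‖ ^ 2 = ⟪(LinearMap.adjoint T ∘ₗ T) w, w⟫ := by
    rw [LinearMap.comp_apply, LinearMap.adjoint_inner_left, real_inner_self_eq_norm_sq]
  rw [h1, ← (hS.eigenvectorBasis hn).sum_inner_mul_inner]
  refine Finset.sum_congr rfl fun i _ => ?_
  rw [hS (w) (hS.eigenvectorBasis hn i), hS.apply_eigenvectorBasis hn i, inner_smul_right,
    real_inner_comm w]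
  simp only [RCLike.ofReal_real_eq_id, id_eq]
  ring

/-- Take `b` to be a top eigenvector of `T* T`; on its orthogonal complement only the later singular
values act. -/
theorem norm_apply_le_singularValue_one (T : E →ₗ[ℝ] E) (hn : 0 < Module.finrank ℝ E) :
    ∃ b : E, ∀ w, ⟪b, w⟫ = 0 → ‖T w‖ ^ 2 ≤ T.singularValues 1 ^ 2 * ‖w‖ ^ 2 := by
  set n := Module.finrank ℝ E with hn'
  set hS := T.isSymmetric_adjoint_comp_self
  set b := hS.eigenvectorBasis hn'.symm
  refine ⟨b ⟨0, hn⟩, fun w hw => ?_⟩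
  rw [norm_sq_apply_eq_sum T hn'.symm w, ← b.sum_sq_norm_inner_right w, Finset.mul_sum]
  refine Finset.sum_le_sum fun i _ => ?_
  rw [Real.norm_eq_abs, sq_abs]
  by_cases hi : i = ⟨0, hn⟩
  · subst hi
    simp [b] at hw ⊢
    rw [hw]; simp
  · have hi0 : 1 ≤ (i : ℕ) := by
      rw [Nat.one_le_iff_ne_zero]
      exact fun h => hi (Fin.ext h)
    gcongr
    rw [← T.sq_singularValues_fin hn'.symm i]
    have := T.singularValues_antitone hi0
    have := T.singularValues_nonneg i
    gcongr

/-- A Courant-Fischer argument: if `μ² > σ²`, then, as also `1 > σ²`, every non-zero vector of the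
plane spanned by `e` and `v` is stretched by more than `σ`. But this plane meets the hyperplane
`b^⊥`, where the stretch is at most `σ`. -/
theorem sq_eigenvalue_le_of_inner_eq_zero (T : E →ₗ[ℝ] E) {e v : E} (he : e ≠ 0) (hv : v ≠ 0)
    (hev : ⟪e, v⟫ = 0) (hTe : T e = e) {μ : ℝ} (hTv : T v = μ • v)
    (hσ : T.singularValues 1 < 1) : μ ^ 2 ≤ T.singularValues 1 ^ 2 := by
  have hpos : 0 < Module.finrank ℝ E := by
    have : Nontrivial E := ⟨e, 0, he⟩
    exact Module.finrank_pos
  obtain ⟨b, hb⟩ := norm_apply_le_singularValue_one T hpos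
  have hσ0 := T.singularValues_nonneg 1
  set σ := T.singularValues 1
  by_contra hlt
  push Not at hlt
  obtain ⟨p, q, hpq, h0⟩ : ∃ p q : ℝ, p * ⟪b, e⟫ + q * ⟪b, v⟫ = 0 ∧ ¬ (p = 0 ∧ q = 0) := by
    by_cases h : ⟪b, v⟫ = 0
    · exact ⟨0, 1, by simp [h], by simp⟩
    · exact ⟨⟪b, v⟫, -⟪b, e⟫, by ring, fun h' => h h'.1⟩
  have h1 := hb (p • e + q • v) (by
    rw [inner_add_right, inner_smul_right, inner_smul_right]; exact hpq)
  have hTw : T (p • e + q • v) = p • e + (q * μ) • v := by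
    rw [map_add, map_smul, map_smul, hTe, hTv, smul_smul]
  have hns : ∀ r s : ℝ, ‖r • e + s • v‖ ^ 2 = r ^ 2 * ‖e‖ ^ 2 + s ^ 2 * ‖v‖ ^ 2 := fun r s => by
    rw [norm_add_sq_real, inner_smul_left, inner_smul_right, hev, norm_smul, norm_smul, mul_pow,
      mul_pow, Real.norm_eq_abs, Real.norm_eq_abs, sq_abs, sq_abs]
    simp
  rw [hTw, hns, hns] at h1
  have he' : 0 < ‖e‖ ^ 2 := by positivity
  have hv' : 0 < ‖v‖ ^ 2 := by positivity
  have hσ2 : σ ^ 2 < 1 := by nlinarith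
  have h2 : 0 ≤ (1 - σ ^ 2) * (p ^ 2 * ‖e‖ ^ 2) := mul_nonneg (by linarith) (by positivity)
  have h3 : 0 ≤ (μ ^ 2 - σ ^ 2) * (q ^ 2 * ‖v‖ ^ 2) := mul_nonneg (by linarith) (by positivity)
  by_cases hp : p = 0
  · have hq : q ≠ 0 := fun hq => h0 ⟨hp, hq⟩
    have : 0 < (μ ^ 2 - σ ^ 2) * (q ^ 2 * ‖v‖ ^ 2) := mul_pos (by linarith) (by positivity)
    nlinarith
  · have : 0 < (1 - σ ^ 2) * (p ^ 2 * ‖e‖ ^ 2) := mul_pos (by linarith) (by positivity)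
    nlinarith

end SingularValue

/-! ### Spectral decomposition of the network disagreement -/

section Spectral

variable {d n : ℕ} {𝒢 : SimpleGraph (Fin n)} {A : Matrix (Fin n) (Fin n) ℝ}

theorem sigma2_nonneg (A : Matrix (Fin n) (Fin n) ℝ) : 0 ≤ sigma2 A :=
  LinearMap.singularValues_nonneg _ _

/-- The network average. -/
def netAvg (X : Fin n → Vec d) : Vec d := (1 / (n : ℝ)) • ∑ i, X i

/-- The coefficient of `X`, regarded as a vector indexed by the learners, along `w`. -/
def netCoeff (w : EuclideanSpace ℝ (Fin n)) (X : Fin n → Vec d) : Vec d := ∑ i, w i • X i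

theorem netCoeff_add (w : EuclideanSpace ℝ (Fin n)) (X Y : Fin n → Vec d) :
    netCoeff w (X + Y) = netCoeff w X + netCoeff w Y := by
  simp [netCoeff, Finset.sum_add_distrib]

theorem netCoeff_sub_const {w : EuclideanSpace ℝ (Fin n)} (hw : ∑ i, w i = 0)
    (X : Fin n → Vec d) (c : Vec d) : netCoeff w (fun i => X i - c) = netCoeff w X := by
  simp only [netCoeff, smul_sub, Finset.sum_sub_distrib, ← Finset.sum_smul, hw, zero_smul,
    sub_zero]

/-- Parseval's identity, applied to each coordinate of the decision space. -/
theorem sum_norm_netCoeff_sq (b : OrthonormalBasis (Fin n) ℝ (EuclideanSpace ℝ (Fin n)))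
    (X : Fin n → Vec d) : ∑ l, ‖netCoeff (b l) X‖ ^ 2 = ∑ i, ‖X i‖ ^ 2 := by
  simp only [EuclideanSpace.norm_sq_eq]
  rw [Finset.sum_comm]
  conv_rhs => rw [Finset.sum_comm]
  refine Finset.sum_congr rfl fun k _ => ?_
  have h := b.sum_sq_norm_inner_right (WithLp.toLp 2 fun i => X i k)
  rw [EuclideanSpace.norm_sq_eq] at h
  rw [← h]
  refine Finset.sum_congr rfl fun l _ => ?_
  congr 2
  simp [netCoeff, PiLp.inner_apply, mul_comm]

theorem sum_sub_netAvg (hn : 0 < n) (X : Fin n → Vec d) : ∑ i, (X i - netAvg X) = 0 := by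
  have : (n : ℝ) ≠ 0 := by exact_mod_cast hn.ne'
  simp only [Finset.sum_sub_distrib, Finset.sum_const, Finset.card_univ, Fintype.card_fin, netAvg]
  rw [← Nat.cast_smul_eq_nsmul ℝ, smul_smul, mul_one_div_cancel this, one_smul, sub_self]

namespace IsCommMatrix

theorem apply_comm (hA : IsCommMatrix 𝒢 A) (i j : Fin n) : A i j = A j i :=
  congrFun (congrFun hA.symm j) i

theorem row_sum (hA : IsCommMatrix 𝒢 A) (i : Fin n) : ∑ j, A i j = 1 :=
  (mem_doublyStochastic_iff_sum.1 hA.doublyStochastic).2.1 i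

theorem col_sum (hA : IsCommMatrix 𝒢 A) (j : Fin n) : ∑ i, A i j = 1 :=
  (mem_doublyStochastic_iff_sum.1 hA.doublyStochastic).2.2 j

theorem netCoeff_mul (hA : IsCommMatrix 𝒢 A) {w : EuclideanSpace ℝ (Fin n)} {μ : ℝ}
    (hw : ∀ i, ∑ j, A i j * w j = μ * w i) (X : Fin n → Vec d) :
    netCoeff w (fun i => ∑ j, A i j • X j) = μ • netCoeff w X := by
  simp only [netCoeff, Finset.smul_sum, smul_smul]
  rw [Finset.sum_comm]
  refine Finset.sum_congr rfl fun j _ => ?_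
  rw [← Finset.sum_smul, ← hw j]
  congr 1
  refine Finset.sum_congr rfl fun i _ => ?_
  rw [hA.apply_comm i j, mul_comm]

theorem eigenvalue_le_sigma2 (hA : IsCommMatrix 𝒢 A) {w : EuclideanSpace ℝ (Fin n)} {μ : ℝ}
    (hw : ∀ i, ∑ j, A i j * w j = μ * w i) (hw0 : w ≠ 0) (hs : ∑ i, w i = 0) :
    μ ≤ sigma2 A := by
  set e : EuclideanSpace ℝ (Fin n) := WithLp.toLp 2 fun _ => 1 with he
  have hTe : Matrix.toEuclideanLin A e = e := by
    ext i
    simp [he, Matrix.mulVec, dotProduct, hA.row_sum]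
  have hTw : Matrix.toEuclideanLin A w = μ • w := by
    ext i
    simp [Matrix.mulVec, dotProduct, hw]
  have he0 : e ≠ 0 := by
    intro h
    apply hw0
    ext i
    have := congrArg (fun x : EuclideanSpace ℝ (Fin n) => x i) h
    simp [he] at this
  have hew : ⟪e, w⟫ = 0 := by
    simp [he, PiLp.inner_apply, hs]
  exact le_trans (le_abs_self μ) (abs_le_of_sq_le_sq
    (sq_eigenvalue_le_of_inner_eq_zero _ he0 hw0 hew hTe hTw hA.sigma_lt) (sigma2_nonneg A))

theorem sum_eq_zero_of_ne_one (hA : IsCommMatrix 𝒢 A) {w : EuclideanSpace ℝ (Fin n)} {μ : ℝ}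
    (hw : ∀ i, ∑ j, A i j * w j = μ * w i) (hμ : μ ≠ 1) : ∑ i, w i = 0 := by
  have h1 : ∑ i, ∑ j, A i j * w j = ∑ j, w j := by
    rw [Finset.sum_comm]
    refine Finset.sum_congr rfl fun j _ => ?_
    rw [← Finset.sum_mul, hA.col_sum, one_mul]
  simp only [hw, ← Finset.mul_sum] at h1
  have h2 : (μ - 1) * ∑ i, w i = 0 := by linarith
  exact (mul_eq_zero.1 h2).resolve_left (sub_ne_zero.2 hμ)

theorem exists_const_of_eigenvalue_one (hA : IsCommMatrix 𝒢 A) (hn : 0 < n)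
    {w : EuclideanSpace ℝ (Fin n)}
    (hw : ∀ i, ∑ j, A i j * w j = w i) : ∃ c, ∀ i, w i = c := by
  have hn' : (n : ℝ) ≠ 0 := by exact_mod_cast hn.ne'
  set c := (∑ i, w i) / n with hc
  refine ⟨c, ?_⟩
  set v : EuclideanSpace ℝ (Fin n) := WithLp.toLp 2 fun i => w i - c with hv
  by_contra hne
  have hv0 : v ≠ 0 := fun h => hne fun i => by
    have := congrArg (fun x : EuclideanSpace ℝ (Fin n) => x i) h
    simp [hv] at this
    linarith
  have h1 : ∑ i, v i = 0 := by
    simp only [hv, Finset.sum_sub_distrib, Finset.sum_const, Finset.card_univ, Fintype.card_fin,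
      nsmul_eq_mul, hc]
    field_simp
    ring
  have h2 := hA.eigenvalue_le_sigma2 (w := v) (μ := 1) (fun i => by
    simp only [hv, mul_sub, Finset.sum_sub_distrib, hw, ← Finset.sum_mul, hA.row_sum]
    ring) hv0 h1
  linarith [hA.sigma_lt]

theorem isHermitian (hA : IsCommMatrix 𝒢 A) : A.IsHermitian := hA.posSemidef.1

theorem mul_eigenvectorBasis (hA : IsCommMatrix 𝒢 A) (l i : Fin n) :
    ∑ j, A i j * hA.isHermitian.eigenvectorBasis l j
      = hA.isHermitian.eigenvalues l * hA.isHermitian.eigenvectorBasis l i := by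
  have := congrFun (hA.isHermitian.mulVec_eigenvectorBasis l) i
  simpa [Matrix.mulVec, dotProduct] using this

theorem eigenvalues_le_sigma2 (hA : IsCommMatrix 𝒢 A) {l : Fin n}
    (hl : hA.isHermitian.eigenvalues l ≠ 1) : hA.isHermitian.eigenvalues l ≤ sigma2 A :=
  hA.eigenvalue_le_sigma2 (hA.mul_eigenvectorBasis l)
    (hA.isHermitian.eigenvectorBasis.orthonormal.ne_zero l)
    (hA.sum_eq_zero_of_ne_one (hA.mul_eigenvectorBasis l) hl)

/-- Eigenvectors for the eigenvalue one are constant and annihilate the centred vector. All others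
have coordinate sum zero and do not see the average. -/
theorem sum_norm_sub_netAvg_sq (hA : IsCommMatrix 𝒢 A) (hn : 0 < n) (X : Fin n → Vec d) :
    ∑ i, ‖X i - netAvg X‖ ^ 2 = ∑ l with hA.isHermitian.eigenvalues l ≠ 1,
      ‖netCoeff (hA.isHermitian.eigenvectorBasis l) X‖ ^ 2 := by
  rw [← sum_norm_netCoeff_sq hA.isHermitian.eigenvectorBasis, Finset.sum_filter]
  refine Finset.sum_congr rfl fun l _ => ?_
  split_ifs with h
  · rw [netCoeff_sub_const (hA.sum_eq_zero_of_ne_one (hA.mul_eigenvectorBasis l) h)]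
  · push Not at h
    obtain ⟨c, hc⟩ := hA.exists_const_of_eigenvalue_one hn
      (w := hA.isHermitian.eigenvectorBasis l) (fun i => by
        rw [hA.mul_eigenvectorBasis, h, one_mul])
    simp only [netCoeff, hc, ← Finset.smul_sum, sum_sub_netAvg hn]
    simp

end IsCommMatrix

end Spectral

/-! ### A quadratic energy for the accelerated recursion -/

section Energy

variable {d : ℕ}

/-- The quadratic form that the recursion `a_{k+1} = (1 + θ) μ a_k - θ a_{k-1}` scales by `θ`. -/
def gossipEnergy (θ μ : ℝ) (a b : Vec d) : ℝ :=
  ‖a‖ ^ 2 - (1 + θ) * μ * ⟪a, b⟫ + θ * ‖b‖ ^ 2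

/-- The form is built from the characteristic polynomial `X² - (1 + θ) μ X + θ`; the companion
matrix scales it by its determinant `θ`. -/
theorem gossipEnergy_step (θ μ : ℝ) (a b : Vec d) :
    gossipEnergy θ μ (((1 + θ) * μ) • a - θ • b) a = θ * gossipEnergy θ μ a b := by
  simp only [gossipEnergy, norm_sub_sq_real, inner_sub_left, inner_smul_left, inner_smul_right,
    norm_smul, mul_pow, Real.norm_eq_abs, sq_abs, RCLike.conj_to_real, real_inner_self_eq_norm_sq,
    real_inner_comm a b]
  ring

theorem gossipEnergy_self (θ μ : ℝ) (a : Vec d) :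
    gossipEnergy θ μ a a = (1 + θ) * (1 - μ) * ‖a‖ ^ 2 := by
  simp only [gossipEnergy, real_inner_self_eq_norm_sq]
  ring

/-- The factor `(1 + θ) (1 - μ)` is the energy of a repeated unit vector (`gossipEnergy_self`).
Keeping it on the left makes the normalized comparison uniform in `μ`, with no loss as `μ → 1`. -/
theorem le_gossipEnergy {σ μ : ℝ} (hμ0 : 0 ≤ μ) (hμ : μ ≤ σ) (hσ : σ < 1) (a b : Vec d) :
    (1 + 1 / (1 + √(1 - σ ^ 2))) * (1 - μ) * (3 / 8 * ‖a‖ ^ 2)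
      ≤ gossipEnergy (1 / (1 + √(1 - σ ^ 2))) μ a b := by
  set s := √(1 - σ ^ 2) with hs
  have hs0 : 0 ≤ s := Real.sqrt_nonneg _
  have hs2 : s ^ 2 = 1 - σ ^ 2 := Real.sq_sqrt (by nlinarith)
  set θ := 1 / (1 + s) with hθ
  have hθ0 : 0 < θ := by positivity
  have h1s : 0 < 1 + s := by linarith
  have hθs : θ * (1 + s) = 1 := by rw [hθ]; field_simp
  -- This is the square completed in `b`; it equals `4 θ` times the energy minus `(4 θ - ((1 + θ)
  -- μ)²) ‖a‖²`.
  have hsq : 0 ≤ ‖(2 * θ) • b - ((1 + θ) * μ) • a‖ ^ 2 := by positivity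
  rw [norm_sub_sq_real, norm_smul, norm_smul, mul_pow, mul_pow, inner_smul_left, inner_smul_right,
    Real.norm_eq_abs, Real.norm_eq_abs, sq_abs, sq_abs, real_inner_comm] at hsq
  simp only [RCLike.conj_to_real] at hsq
  have h1 : (4 * θ - ((1 + θ) * μ) ^ 2) * ‖a‖ ^ 2 ≤ 4 * θ * gossipEnergy θ μ a b := by
    unfold gossipEnergy
    nlinarith
  have hμs : s ^ 2 ≤ 1 - μ ^ 2 := by rw [hs2]; nlinarith
  have h2 : 3 * (2 + s) * (1 - μ) ≤ 8 * (1 + s) - 2 * (2 + s) ^ 2 * μ ^ 2 := by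
    have h3 : 8 * (1 + s) - 2 * (2 + s) ^ 2 * μ ^ 2
      = 2 * (2 + s) ^ 2 * (1 - μ ^ 2) - 2 * s ^ 2 := by ring
    have h4 : 1 - μ ≤ 1 - μ ^ 2 := by nlinarith
    have h5 : 0 ≤ 1 - μ := by linarith
    -- `s² ≤ 1 - μ²` pays for the term `-2 s²`. The step `1 - μ ≤ 1 - μ²` needs `μ ≥ 0`, which comes
    -- from positive semidefiniteness of the matrix.
    have h6 : (2 * (2 + s) ^ 2 - 2) * (1 - μ) ≤ (2 * (2 + s) ^ 2 - 2) * (1 - μ ^ 2) :=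
      mul_le_mul_of_nonneg_left h4 (by nlinarith)
    have h7 : 0 ≤ (2 * s ^ 2 + 5 * s) * (1 - μ) := mul_nonneg (by positivity) h5
    rw [h3]
    nlinarith
  have h8 : (1 + θ) * (1 - μ) * (3 / 8) * (4 * θ) ≤ 4 * θ - ((1 + θ) * μ) ^ 2 := by
    have e1 : (1 + θ) * (1 - μ) * (3 / 8) * (4 * θ) = θ ^ 2 / 2 * (3 * (2 + s) * (1 - μ)) := by
      have : 1 + θ = θ * (2 + s) := by linarith
      rw [this]; ring
    have e2 : 4 * θ - ((1 + θ) * μ) ^ 2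
        = θ ^ 2 / 2 * (8 * (1 + s) - 2 * (2 + s) ^ 2 * μ ^ 2) := by
      have : 1 + θ = θ * (2 + s) := by linarith
      rw [this]
      have : 4 * θ = 4 * θ * (θ * (1 + s)) := by rw [hθs, mul_one]
      rw [this]; ring
    rw [e1, e2]
    exact mul_le_mul_of_nonneg_left h2 (by positivity)
  have h9 := mul_le_mul_of_nonneg_right h8 (sq_nonneg ‖a‖)
  refine le_of_mul_le_mul_left ?_ (show 0 < 4 * θ by positivity)
  linarith

/-- The parallelogram identity for the energy, with the energy of the difference dropped. -/
theorem gossipEnergy_add_le {θ μ : ℝ} (h : ∀ a b : Vec d, 0 ≤ gossipEnergy θ μ a b)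
    (a b c : Vec d) : gossipEnergy θ μ (a + c) (b + c)
      ≤ 2 * (gossipEnergy θ μ a b + (1 + θ) * (1 - μ) * ‖c‖ ^ 2) := by
  have h1 := h (a - c) (b - c)
  rw [← gossipEnergy_self]
  simp only [gossipEnergy, norm_sub_sq_real, norm_add_sq_real, inner_sub_left, inner_sub_right,
    inner_add_left, inner_add_right] at h1 ⊢
  linarith

end Energy

/-! ### Accelerated gossip: exact average, bounded deviation -/

section Gossip

variable {d n : ℕ} {𝒢 : SimpleGraph (Fin n)} {A : Matrix (Fin n) (Fin n) ℝ}

theorem IsCommMatrix.netCoeff_gossipStep (hA : IsCommMatrix 𝒢 A)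
    {w : EuclideanSpace ℝ (Fin n)} {μ : ℝ} (hw : ∀ i, ∑ j, A i j * w j = μ * w i) (θ : ℝ)
    (X : (Fin n → Vec d) × (Fin n → Vec d)) :
    netCoeff w (gossipStep A θ X).1 = ((1 + θ) * μ) • netCoeff w X.1 - θ • netCoeff w X.2 := by
  rw [mul_smul, ← hA.netCoeff_mul hw X.1]
  simp only [netCoeff, gossipStep]
  rw [Finset.smul_sum, Finset.smul_sum, ← Finset.sum_sub_distrib]
  refine Finset.sum_congr rfl fun i _ => ?_
  rw [smul_sub, smul_comm (w i), smul_comm (w i) θ]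

theorem IsCommMatrix.gossipEnergy_iterate (hA : IsCommMatrix 𝒢 A)
    {w : EuclideanSpace ℝ (Fin n)} {μ : ℝ} (hw : ∀ i, ∑ j, A i j * w j = μ * w i) (θ : ℝ)
    (X : (Fin n → Vec d) × (Fin n → Vec d)) (N : ℕ) :
    gossipEnergy θ μ (netCoeff w ((gossipStep A θ)^[N] X).1)
        (netCoeff w ((gossipStep A θ)^[N] X).2)
      = θ ^ N * gossipEnergy θ μ (netCoeff w X.1) (netCoeff w X.2) := by
  induction N with
  | zero => simp
  | succ N ih =>
    rw [Function.iterate_succ_apply', hA.netCoeff_gossipStep hw, pow_succ', mul_assoc, ← ih,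
      ← gossipEnergy_step]
    rfl

theorem netAvg_add (X Y : Fin n → Vec d) : netAvg (X + Y) = netAvg X + netAvg Y := by
  simp [netAvg, Finset.sum_add_distrib]

theorem IsCommMatrix.netAvg_gossipStep (hA : IsCommMatrix 𝒢 A) (θ : ℝ)
    (X : (Fin n → Vec d) × (Fin n → Vec d)) (h : netAvg X.1 = netAvg X.2) :
    netAvg (gossipStep A θ X).1 = netAvg X.1 ∧ netAvg (gossipStep A θ X).2 = netAvg X.1 := by
  refine ⟨?_, rfl⟩
  have h1 : ∑ i, ∑ j, A i j • X.1 j = ∑ j, X.1 j := by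
    rw [Finset.sum_comm]
    refine Finset.sum_congr rfl fun j _ => ?_
    rw [← Finset.sum_smul, hA.col_sum, one_smul]
  have h2 : netAvg (gossipStep A θ X).1 = (1 + θ) • netAvg X.1 - θ • netAvg X.2 := by
    simp only [netAvg, gossipStep, Finset.sum_sub_distrib, ← Finset.smul_sum, h1, smul_sub]
    rw [smul_comm, smul_comm θ]
  rw [h2, ← h]
  module

theorem IsCommMatrix.netAvg_iterate (hA : IsCommMatrix 𝒢 A) (θ : ℝ)
    (X : (Fin n → Vec d) × (Fin n → Vec d)) (h : netAvg X.1 = netAvg X.2) (N : ℕ) :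
    netAvg ((gossipStep A θ)^[N] X).1 = netAvg X.1 ∧
      netAvg ((gossipStep A θ)^[N] X).2 = netAvg X.1 := by
  induction N with
  | zero => exact ⟨rfl, h.symm⟩
  | succ N ih =>
    rw [Function.iterate_succ_apply']
    have := hA.netAvg_gossipStep θ ((gossipStep A θ)^[N] X) (by rw [ih.1, ih.2])
    exact ⟨this.1.trans ih.1, this.2.trans ih.1⟩

/-- The averages of both components agree at all times, and the gossip weights `1 + θ` and `-θ` sum
to one, so mixing never changes the average. -/
theorem IsCommMatrix.netAvg_dual {p : ADFTRLParams d n} (hA : IsCommMatrix 𝒢 p.A)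
    (c : Losses d n) (q : ℕ) :
    netAvg (p.dual c q).1 = ∑ s ∈ Finset.range q, netAvg (p.blockGrad c s) ∧
      netAvg (p.dual c q).2 = ∑ s ∈ Finset.range q, netAvg (p.blockGrad c s) := by
  induction q with
  | zero => simp [ADFTRLParams.dual, netAvg]
  | succ q ih =>
    rw [Finset.sum_range_succ, ADFTRLParams.dual]
    have := hA.netAvg_iterate p.θ
      ((p.dual c q).1 + p.blockGrad c q, (p.dual c q).2 + p.blockGrad c q)
      (by simp only [netAvg_add, ih.1, ih.2]) p.N
    simp only [netAvg_add, ih.1] at this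
    exact this

theorem IsCommMatrix.pow_mixing_le (hA : IsCommMatrix 𝒢 A) (hn : 0 < n) {N : ℕ}
    (hN : commC A ≤ N) :
    (1 / (1 + √(1 - sigma2 A ^ 2))) ^ N ≤ 1 / (14 * (n : ℝ)) := by
  have hσ := hA.sigma_lt
  have hσ0 := sigma2_nonneg A
  have hn1 : (1 : ℝ) ≤ n := by exact_mod_cast hn
  set x := √(gap A) with hx
  have hx0 : 0 < x := Real.sqrt_pos.2 (by unfold gap; linarith)
  have hx1 : x ≤ 1 := by rw [hx, Real.sqrt_le_one]; unfold gap; linarith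
  have hxs : x ≤ √(1 - sigma2 A ^ 2) := Real.sqrt_le_sqrt (by unfold gap; nlinarith)
  have hlog0 : 0 ≤ Real.log (14 * n) := Real.log_nonneg (by linarith)
  have hC : √2 * Real.log (√(14 * (n : ℝ))) / ((√2 - 1) * x) ≤ N :=
    (Nat.le_ceil _).trans (Nat.cast_le.2 hN)
  have h2 : √2 ^ 2 = 2 := Real.sq_sqrt (by norm_num)
  have h20 : 0 ≤ √2 := Real.sqrt_nonneg 2
  have h21 : 1 < √2 := by nlinarith
  have h22 : √2 ≤ 3 / 2 := by nlinarith
  rw [Real.log_sqrt (by positivity), div_le_iff₀ (mul_pos (by linarith) hx0)] at hC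
  -- The `1/2` from the logarithm of the square root leaves `√2 / (2 (√2 - 1)) ≥ 3/2`. It
  -- compensates the factor `2/3` in `log (1 + x) ≥ (2/3) x`, valid for `x ≤ 1`.
  have hNx : 3 / 2 * Real.log (14 * n) ≤ N * x := by
    have : (√2 - 1) * (3 / 2 * Real.log (14 * n)) ≤ (√2 - 1) * (N * x) := by nlinarith
    exact le_of_mul_le_mul_left this (by linarith)
  have hl := Real.le_log_one_add_of_nonneg hx0.le
  have hl2 : 2 / 3 * x ≤ Real.log (1 + x) := by
    refine le_trans ?_ hl
    rw [le_div_iff₀ (by linarith)]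
    nlinarith
  have hlogN : Real.log (14 * n) ≤ N * Real.log (1 + x) := by
    have : (N : ℝ) * (2 / 3 * x) ≤ N * Real.log (1 + x) := by gcongr
    linarith
  rw [← Real.log_pow] at hlogN
  have h3 := (Real.log_le_log_iff (by positivity) (by positivity)).1 hlogN
  rw [one_div_pow]
  refine one_div_le_one_div_of_le (by positivity) (h3.trans ?_)
  gcongr

/-- Injecting a block gradient at most doubles the normalized energy plus `n B²`, and the `N` gossip
steps then divide by `14 n`. The recursion is stable, with a bound independent of the number of
blocks and of `n`. -/
theorem IsCommMatrix.sum_norm_dual_sub_sq_le {p : ADFTRLParams d n} (hA : IsCommMatrix 𝒢 p.A)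
    (hn : 0 < n) (hθ : p.θ = 1 / (1 + √(1 - sigma2 p.A ^ 2)))
    (hN : commC p.A ≤ p.N) (c : Losses d n) {B : ℝ}
    (hc : ∀ q i, ‖p.blockGrad c q i‖ ≤ B) (q : ℕ) :
    ∑ i, ‖(p.dual c q).1 i - netAvg (p.dual c q).1‖ ^ 2 ≤ B ^ 2 := by
  have hn1 : (1 : ℝ) ≤ n := by exact_mod_cast hn
  set θ := p.θ
  set b := hA.isHermitian.eigenvectorBasis with hb
  set μ := hA.isHermitian.eigenvalues with hμ
  set S : Finset (Fin n) := {l | μ l ≠ 1} with hS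
  have hσ := hA.sigma_lt
  have hμσ : ∀ l ∈ S, μ l ≤ sigma2 p.A := fun l hl =>
    hA.eigenvalues_le_sigma2 (by simpa [hS] using hl)
  have hμ0 : ∀ l, 0 ≤ μ l := fun l => hA.posSemidef.eigenvalues_nonneg l
  have hw := fun l => hA.mul_eigenvectorBasis l
  have hθ0 : 0 < θ := by rw [hθ]; positivity
  have hpos : ∀ l ∈ S, 0 < (1 + θ) * (1 - μ l) := fun l hl =>
    mul_pos (by linarith) (by linarith [hμσ l hl])
  have hle : ∀ l ∈ S, ∀ u v : Vec d, (1 + θ) * (1 - μ l) * (3 / 8 * ‖u‖ ^ 2)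
      ≤ gossipEnergy θ (μ l) u v := fun l hl u v => by
    rw [hθ]; exact le_gossipEnergy (hμ0 l) (hμσ l hl) hσ u v
  have hE0 : ∀ l ∈ S, ∀ u v : Vec d, 0 ≤ gossipEnergy θ (μ l) u v := fun l hl u v =>
    le_trans (mul_nonneg (hpos l hl).le (by positivity)) (hle l hl u v)
  set W : ℕ → ℝ := fun q => ∑ l ∈ S, gossipEnergy θ (μ l) (netCoeff (b l) (p.dual c q).1)
    (netCoeff (b l) (p.dual c q).2) / ((1 + θ) * (1 - μ l)) with hW
  have hWdev : ∀ q, ∑ i, ‖(p.dual c q).1 i - netAvg (p.dual c q).1‖ ^ 2 ≤ 8 / 3 * W q := by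
    intro q
    rw [hA.sum_norm_sub_netAvg_sq hn, hW, Finset.mul_sum]
    refine Finset.sum_le_sum fun l hl => ?_
    have := hle l hl (netCoeff (b l) (p.dual c q).1) (netCoeff (b l) (p.dual c q).2)
    have h1 : 3 / 8 * ‖netCoeff (b l) (p.dual c q).1‖ ^ 2
      ≤ gossipEnergy θ (μ l) (netCoeff (b l) (p.dual c q).1)
      (netCoeff (b l) (p.dual c q).2) / ((1 + θ) * (1 - μ l)) := by
      rw [le_div_iff₀ (hpos l hl)]
      linarith
    linarith
  have hθN : θ ^ p.N ≤ 1 / (14 * (n : ℝ)) := by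
    rw [hθ]; exact hA.pow_mixing_le hn hN
  have hstep : ∀ q, W (q + 1) ≤ 1 / (7 * n) * (W q + n * B ^ 2) := by
    intro q
    have h1 : ∑ l ∈ S, ‖netCoeff (b l) (p.blockGrad c q)‖ ^ 2 ≤ n * B ^ 2 := by
      calc _ ≤ ∑ l, ‖netCoeff (b l) (p.blockGrad c q)‖ ^ 2 :=
            Finset.sum_le_sum_of_subset_of_nonneg (Finset.subset_univ _) fun _ _ _ => by positivity
        _ = ∑ i, ‖p.blockGrad c q i‖ ^ 2 := sum_norm_netCoeff_sq b _
        _ ≤ ∑ _i : Fin n, B ^ 2 := by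
            refine Finset.sum_le_sum fun i _ => ?_
            have := hc q i
            gcongr
        _ = n * B ^ 2 := by simp
    have h2 : W (q + 1) ≤ ∑ l ∈ S, 1 / (7 * (n : ℝ)) *
        (gossipEnergy θ (μ l) (netCoeff (b l) (p.dual c q).1)
          (netCoeff (b l) (p.dual c q).2) / ((1 + θ) * (1 - μ l))
          + ‖netCoeff (b l) (p.blockGrad c q)‖ ^ 2) := by
      refine Finset.sum_le_sum fun l hl => ?_
      have hp := hpos l hl
      rw [ADFTRLParams.dual, hA.gossipEnergy_iterate (hw l)]
      simp only [netCoeff_add]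
      have h3 := gossipEnergy_add_le (hE0 l hl) (netCoeff (b l) (p.dual c q).1)
        (netCoeff (b l) (p.dual c q).2) (netCoeff (b l) (p.blockGrad c q))
      have h4 := mul_le_mul hθN h3 (hE0 l hl _ _) (by positivity)
      rw [div_le_iff₀ hp]
      refine h4.trans (le_of_eq ?_)
      generalize (1 + θ) * (1 - μ l) = κ at hp ⊢
      have := hp.ne'
      field_simp
      ring
    refine h2.trans ?_
    rw [← Finset.mul_sum, Finset.sum_add_distrib]
    gcongr
  -- `B² / 6` is the fixed point of the recursion for `n = 1`: `(1/7) (1/6 + 1) = 1/6`.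
  have hWB : ∀ q, W q ≤ B ^ 2 / 6 := by
    intro q
    induction q with
    | zero =>
      have : W 0 = 0 := by
        simp [hW, ADFTRLParams.dual, netCoeff, gossipEnergy]
      rw [this]; positivity
    | succ q ih =>
      refine (hstep q).trans ?_
      rw [one_div, inv_mul_le_iff₀ (by positivity)]
      nlinarith [sq_nonneg B]
  have := hWdev q
  have := hWB q
  nlinarith [sq_nonneg B]

end Gossip

/-! ### Pathwise regret and disagreement for linear losses -/

section LinearRegret

variable {d n : ℕ}

theorem sum_range_mul_eq {M : Type*} [AddCommMonoid M] (f : ℕ → M) (Q L : ℕ) :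
    ∑ t ∈ Finset.range (Q * L), f t
      = ∑ q ∈ Finset.range Q, ∑ s ∈ Finset.range L, f (q * L + s) := by
  induction Q with
  | zero => simp
  | succ Q ih => rw [Nat.succ_mul, Finset.sum_range_add, ih, Finset.sum_range_succ]

theorem norm_netAvg_le (hn : 0 < n) {X : Fin n → Vec d} {B : ℝ} (hX : ∀ i, ‖X i‖ ≤ B) :
    ‖netAvg X‖ ≤ B := by
  have hn' : (0 : ℝ) < n := by exact_mod_cast hn
  rw [netAvg, norm_smul, Real.norm_of_nonneg (by positivity), one_div, inv_mul_le_iff₀ hn']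
  calc ‖∑ i, X i‖ ≤ ∑ i, ‖X i‖ := norm_sum_le _ _
    _ ≤ ∑ _i : Fin n, B := Finset.sum_le_sum fun i _ => hX i
    _ = n * B := by simp

namespace ADFTRLParams

variable {p : ADFTRLParams d n} {K : Set (Vec d)} {R : ℝ} {c : Losses d n}

theorem norm_blockGrad_le {b : ℝ} (hc : ∀ t i, ‖c t i‖ ≤ b) (q : ℕ) (i : Fin n) :
    ‖p.blockGrad c q i‖ ≤ p.L * b := by
  calc ‖p.blockGrad c q i‖ ≤ ∑ s ∈ Finset.range p.L, ‖c (q * p.L + s) i‖ := norm_sum_le _ _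
    _ ≤ ∑ _s ∈ Finset.range p.L, b := Finset.sum_le_sum fun s _ => hc _ _
    _ = p.L * b := by simp

theorem primal_mem (hK : Convex ℝ K) (hlo : IsLinearOracle K p.lo) (hx₀ : p.x₀ ∈ K) :
    ∀ q i, p.primal c q i ∈ K
  | 0, _ => hx₀
  | 1, _ => hx₀
  | q + 2, i => cgStep_iterate_mem hK hlo _ _ (primal_mem hK hlo hx₀ (q + 1) i) _

variable {𝒢 : SimpleGraph (Fin n)}

/-- Passes through the exact minimizer for the learner's own dual variable: optimization error on
one side, gossip error on the other. The truncated `q - 2` covers the first two blocks, where the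
decision is `v 0`. -/
theorem norm_primal_sub_le (hK : IsDecisionSet K R) (hR : 0 ≤ R) (hA : IsCommMatrix 𝒢 p.A)
    (hn : 0 < n) (hθ : p.θ = 1 / (1 + √(1 - sigma2 p.A ^ 2))) (hN : commC p.A ≤ p.N)
    (hh : 0 < p.h) (hL : 0 < p.L) (hlo : IsLinearOracle K p.lo)
    (hx₀ : IsArgmin (fun x => ‖x‖) K p.x₀) {B : ℝ} (hB : 0 ≤ B)
    (hc : ∀ q i, ‖p.blockGrad c q i‖ ≤ B) {v : ℕ → Vec d}
    (hv : ∀ q, IsFtrlMin (closure K) p.h (∑ s ∈ Finset.range q, netAvg (p.blockGrad c s)) (v q))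
    (q : ℕ) (i : Fin n) :
    ‖p.primal c q i - v (q - 2)‖ ≤ 4 * R / √p.L + B / (2 * p.h) := by
  have h0 : v 0 = p.x₀ := IsFtrlMin.eq_of_isArgmin hh hx₀ (by simpa using hv 0)
  have hw : 0 ≤ 4 * R / √p.L + B / (2 * p.h) := by positivity
  match q with
  | 0 => simpa [primal, h0] using hw
  | 1 => simpa [primal, h0] using hw
  | q + 2 =>
    obtain ⟨u, hu⟩ := exists_isFtrlMin isClosed_closure hK.convex.closure
      ⟨p.x₀, subset_closure hx₀.1⟩ hh ((p.dual c q).1 i)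
    have h1 := norm_cgStep_iterate_sub_le hK hR hh hlo
      (primal_mem (c := c) hK.convex hlo hx₀.1 (q + 1) i) hu hL
    have h2 := hu.norm_sub_le hh (hv q)
    have h3 : ‖(p.dual c q).1 i - netAvg (p.dual c q).1‖ ≤ B := by
      refine abs_le_of_sq_le_sq' ?_ hB |>.2
      exact (Finset.single_le_sum (f := fun i => ‖(p.dual c q).1 i - netAvg (p.dual c q).1‖ ^ 2)
        (fun _ _ => by positivity) (Finset.mem_univ i)).trans
        (hA.sum_norm_dual_sub_sq_le hn hθ hN c hc q)
    rw [(hA.netAvg_dual c q).1] at h3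
    have h4 : ‖u - v q‖ ≤ B / (2 * p.h) := h2.trans (by gcongr)
    calc ‖p.primal c (q + 2) i - v q‖
        ≤ ‖p.primal c (q + 2) i - u‖ + ‖u - v q‖ := norm_sub_le_norm_sub_add_norm_sub _ _ _
      _ ≤ _ := add_le_add h1 h4

theorem sum_inner_leader_le (hK : IsDecisionSet K R) (hh : 0 < p.h) (hn : 0 < n) (hL : 0 < p.L)
    {T : ℕ} (hcT : ∀ t, T ≤ t → c t = 0) {v : ℕ → Vec d}
    (hv : ∀ q, IsFtrlMin (closure K) p.h (∑ s ∈ Finset.range q, netAvg (p.blockGrad c s)) (v q))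
    {y : Vec d} (hy : y ∈ K) :
    ∑ t ∈ Finset.range T, ∑ j, ⟪c t j, v (t / p.L + 1) - y⟫ ≤ n * (p.h * R ^ 2) := by
  have hn' : (n : ℝ) ≠ 0 := by exact_mod_cast hn.ne'
  -- The blocks are completed beyond `T`, where the losses vanish.
  set Q := T / p.L + 1 with hQ
  have hTQ : T ≤ Q * p.L := by
    have := Nat.lt_div_mul_add (a := T) hL
    rw [hQ, Nat.succ_mul]
    exact this.le
  have h1 : ∑ t ∈ Finset.range T, ∑ j, ⟪c t j, v (t / p.L + 1) - y⟫
      = ∑ t ∈ Finset.range (Q * p.L), ∑ j, ⟪c t j, v (t / p.L + 1) - y⟫ := by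
    refine Finset.sum_subset (Finset.range_subset_range.2 hTQ) fun t _ ht => ?_
    rw [Finset.mem_range, not_lt] at ht
    simp [hcT t ht]
  have h2 : ∀ q, ∑ s ∈ Finset.range p.L, ∑ j, ⟪c (q * p.L + s) j, v ((q * p.L + s) / p.L + 1) - y⟫
      = n * ⟪netAvg (p.blockGrad c q), v (q + 1) - y⟫ := by
    intro q
    rw [netAvg, real_inner_smul_left, ← mul_assoc, mul_one_div_cancel hn', one_mul, sum_inner]
    simp only [blockGrad, sum_inner]
    rw [Finset.sum_comm]
    refine Finset.sum_congr rfl fun j _ => Finset.sum_congr rfl fun s hs => ?_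
    have : (q * p.L + s) / p.L = q := by
      rw [mul_comm, Nat.mul_add_div hL, Nat.div_eq_of_lt (Finset.mem_range.1 hs), add_zero]
    rw [this]
  rw [h1, sum_range_mul_eq, Finset.sum_congr rfl fun q _ => h2 q, ← Finset.mul_sum]
  have h3 := IsFtrlMin.be_the_leader hh.le _ v hv Q (subset_closure hy)
  have h4 : ‖y‖ ^ 2 ≤ R ^ 2 := by
    have := hK.norm_le y hy
    gcongr
  have h5 : p.h * ‖y‖ ^ 2 ≤ p.h * R ^ 2 := by gcongr
  exact mul_le_mul_of_nonneg_left (h3.trans h5) (by positivity)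

/-- With `w` the optimization error and `e` the length of a leader move, which also bounds the
gossip error, every decision is within `w + e` of `v (q - 2)`. It is thus within `w + 4 e` of `v (q
+ 1)`, and two learners differ by at most `2 (w + e)`. -/
theorem linear_regret_le (hK : IsDecisionSet K R) (hR : 0 ≤ R) (hA : IsCommMatrix 𝒢 p.A)
    (hn : 0 < n) (hθ : p.θ = 1 / (1 + √(1 - sigma2 p.A ^ 2))) (hN : commC p.A ≤ p.N)
    (hh : 0 < p.h) (hL : 0 < p.L) (hlo : IsLinearOracle K p.lo)
    (hx₀ : IsArgmin (fun x => ‖x‖) K p.x₀) {b G : ℝ} (hb : 0 ≤ b) (hG : 0 ≤ G)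
    (hc : ∀ t i, ‖c t i‖ ≤ b) {T : ℕ} (hcT : ∀ t, T ≤ t → c t = 0)
    (i : Fin n) {y : Vec d} (hy : y ∈ K) :
    ∑ t ∈ Finset.range T, ∑ j, (⟪c t j, p.primal c (t / p.L) j - y⟫
        + G / 2 * ‖p.primal c (t / p.L) i - p.primal c (t / p.L) j‖)
      ≤ n * (p.h * R ^ 2) + T * (n * (b * (4 * R / √p.L + 4 * (p.L * b / (2 * p.h)))
        + G * (4 * R / √p.L + p.L * b / (2 * p.h)))) := by
  have hne : (closure K).Nonempty := ⟨p.x₀, subset_closure hx₀.1⟩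
  choose v hv using fun q => exists_isFtrlMin isClosed_closure hK.convex.closure hne hh
    (∑ s ∈ Finset.range q, netAvg (p.blockGrad c s))
  have hB : 0 ≤ p.L * b := by positivity
  set e := p.L * b / (2 * p.h) with he
  set w := 4 * R / √p.L with hw
  have he0 : 0 ≤ e := by positivity
  have hblock := norm_blockGrad_le (p := p) hc
  have hd := norm_primal_sub_le hK hR hA hn hθ hN hh hL hlo hx₀ hB hblock hv
  rw [← he, ← hw] at hd
  have hstep : ∀ a, ‖v a - v (a + 1)‖ ≤ e := by
    intro a
    refine ((hv a).norm_sub_le hh (hv (a + 1))).trans ?_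
    rw [Finset.sum_range_succ, sub_add_cancel_left, norm_neg]
    exact div_le_div_of_nonneg_right (norm_netAvg_le hn (hblock a)) (by positivity)
  have hsteps : ∀ a k : ℕ, ‖v a - v (a + k)‖ ≤ k * e := by
    intro a k
    induction k with
    | zero => simp
    | succ k ih =>
      have h1 := norm_sub_le_norm_sub_add_norm_sub (v a) (v (a + k)) (v (a + (k + 1)))
      have h2 := hstep (a + k)
      push_cast
      rw [← add_assoc] at h1 ⊢
      linarith
  have hlead : ∀ q j, ‖p.primal c q j - v (q + 1)‖ ≤ w + 4 * e := by
    intro q j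
    obtain ⟨k, hk, hk3⟩ : ∃ k, q + 1 = q - 2 + k ∧ k ≤ 3 := ⟨q + 1 - (q - 2), by omega, by omega⟩
    have h1 := norm_sub_le_norm_sub_add_norm_sub (p.primal c q j) (v (q - 2)) (v (q + 1))
    have h2 := hsteps (q - 2) k
    rw [← hk] at h2
    have h3 : (k : ℝ) * e ≤ 3 * e := by
      have : (k : ℝ) ≤ 3 := by exact_mod_cast hk3
      gcongr
    linarith [hd q j]
  have hcons : ∀ q j, ‖p.primal c q i - p.primal c q j‖ ≤ 2 * (w + e) := by
    intro q j
    have h1 := norm_sub_le_norm_sub_add_norm_sub (p.primal c q i) (v (q - 2)) (p.primal c q j)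
    rw [norm_sub_rev (v (q - 2))] at h1
    linarith [hd q i, hd q j]
  have hterm : ∀ t j, ⟪c t j, p.primal c (t / p.L) j - y⟫
        + G / 2 * ‖p.primal c (t / p.L) i - p.primal c (t / p.L) j‖
      ≤ ⟪c t j, v (t / p.L + 1) - y⟫ + (b * (w + 4 * e) + G * (w + e)) := by
    intro t j
    have h1 : ⟪c t j, p.primal c (t / p.L) j - v (t / p.L + 1)⟫ ≤ b * (w + 4 * e) :=
      (real_inner_le_norm _ _).trans (mul_le_mul (hc t j) (hlead _ j) (norm_nonneg _) hb)
    have h2 : G / 2 * ‖p.primal c (t / p.L) i - p.primal c (t / p.L) j‖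
        ≤ G / 2 * (2 * (w + e)) :=
      mul_le_mul_of_nonneg_left (hcons _ j) (by linarith)
    simp only [inner_sub_right] at h1 ⊢
    linarith
  have hsum := Finset.sum_le_sum fun t (_ : t ∈ Finset.range T) =>
    Finset.sum_le_sum fun j (_ : j ∈ (Finset.univ : Finset (Fin n))) => hterm t j
  refine hsum.trans ?_
  simp only [Finset.sum_add_distrib, Finset.sum_const, Finset.card_univ, Fintype.card_fin,
    Finset.card_range, nsmul_eq_mul]
  have := sum_inner_leader_le (R := R) hK hh hn hL hcT hv hy
  linarith

end ADFTRLParams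

end LinearRegret

/-! ### The tuned parameters -/

section Tuning

theorem sq_rpow_three_quarters (T : ℕ) : ((T : ℝ) ^ (3 / 4 : ℝ)) ^ 2 = T * √T := by
  have hT : (0 : ℝ) ≤ T := Nat.cast_nonneg T
  rw [← Real.rpow_natCast, ← Real.rpow_mul hT, Real.sqrt_eq_rpow]
  rcases hT.eq_or_lt with h | h
  · rw [← h]; norm_num
  · rw [← Real.rpow_one_add' hT (by norm_num)]
    norm_num

theorem sqrt_le_rpow_three_quarters (T : ℕ) : √(T : ℝ) ≤ (T : ℝ) ^ (3 / 4 : ℝ) := by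
  rcases Nat.eq_zero_or_pos T with rfl | h
  · simp
  have hT : (1 : ℝ) ≤ T := by exact_mod_cast h
  refine abs_le_of_sq_le_sq' ?_ (by positivity) |>.2
  rw [sq_rpow_three_quarters, Real.sq_sqrt (by linarith)]
  have : 1 ≤ √(T : ℝ) := Real.one_le_sqrt.2 hT
  nlinarith

theorem div_sqrt_le_rpow {T L : ℕ} (hL0 : 0 < L) (hL : √(T : ℝ) ≤ L) :
    (T : ℝ) / √L ≤ (T : ℝ) ^ (3 / 4 : ℝ) := by
  have hL' : (0 : ℝ) < L := by exact_mod_cast hL0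
  refine abs_le_of_sq_le_sq' ?_ (by positivity) |>.2
  rw [sq_rpow_three_quarters, div_pow, Real.sq_sqrt hL'.le, div_le_iff₀ hL']
  have h1 : √(T : ℝ) * √T = T := Real.mul_self_sqrt (Nat.cast_nonneg T)
  have h2 : (T : ℝ) * (√T * √T) ≤ T * (√T * L) := by gcongr
  nlinarith

theorem sqrt_mul_max_le (T C : ℕ) :
    √(6 * ((max ⌈√(T : ℝ)⌉₊ C : ℕ) : ℝ) * T)
      ≤ √(6 * T * C) + 2 * √3 * (T : ℝ) ^ (3 / 4 : ℝ) := by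
  rcases Nat.eq_zero_or_pos T with rfl | hpos
  · simp
  have hT : (1 : ℝ) ≤ T := by exact_mod_cast hpos
  have h1 : 1 ≤ √(T : ℝ) := Real.one_le_sqrt.2 hT
  rcases max_cases ⌈√(T : ℝ)⌉₊ C with ⟨h, _⟩ | ⟨h, _⟩ <;> rw [h]
  · have : √(6 * (⌈√(T : ℝ)⌉₊ : ℝ) * T) ≤ 2 * √3 * (T : ℝ) ^ (3 / 4 : ℝ) := by
      rw [Real.sqrt_le_left (by positivity), mul_pow, mul_pow, sq_rpow_three_quarters,
        Real.sq_sqrt (by norm_num)]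
      -- Rounding up costs at most a factor two as `T ≥ 1`; this is the source of `√12 = 2 √3`.
      have h2 : (⌈√(T : ℝ)⌉₊ : ℝ) ≤ 2 * √T := by
        have := (Nat.ceil_lt_add_one (Real.sqrt_nonneg (T : ℝ))).le
        linarith
      have h3 : (⌈√(T : ℝ)⌉₊ : ℝ) * T ≤ 2 * √T * T := by gcongr
      linarith
    linarith [Real.sqrt_nonneg (6 * (T : ℝ) * C)]
  · have e : 6 * (C : ℝ) * T = 6 * T * C := by ring
    rw [e]
    have : 0 ≤ 2 * √3 * (T : ℝ) ^ (3 / 4 : ℝ) := by positivity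
    linarith

theorem tuned_bound_le {n T L C : ℕ} {G R : ℝ} (hG : 0 < G) (hR : 0 < R) (hT : 0 < T)
    (hLdef : L = max ⌈√(T : ℝ)⌉₊ C) :
    n * (√(6 * L * T) * G / R * R ^ 2) + T * (n * (3 / 8 * G * (4 * R / √L
        + 4 * (L * (3 / 8 * G) / (2 * (√(6 * L * T) * G / R))))
        + G * (4 * R / √L + L * (3 / 8 * G) / (2 * (√(6 * L * T) * G / R)))))
      ≤ 2 * n * G * R * √(6 * T * C) + (4 * √3 + 13) * n * G * R * (T : ℝ) ^ (3 / 4 : ℝ) := by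
  have hT' : (0 : ℝ) < T := by exact_mod_cast hT
  have hL1 : √(T : ℝ) ≤ L := (Nat.le_ceil _).trans (by
    rw [hLdef]; exact_mod_cast le_max_left _ _)
  have hL' : (0 : ℝ) < L := (Real.sqrt_pos.2 hT').trans_le hL1
  have hL0 : 0 < L := by exact_mod_cast hL'
  have hS := sqrt_mul_max_le T C
  rw [← hLdef] at hS
  have ha := div_sqrt_le_rpow hL0 hL1
  set a := (T : ℝ) ^ (3 / 4 : ℝ)
  set S := √(6 * L * T) with hSdef
  have hS0 : 0 < S := Real.sqrt_pos.2 (by positivity)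
  have hS2 : S ^ 2 = 6 * L * T := Real.sq_sqrt (by positivity)
  have ha0 : 0 ≤ a := by positivity
  have he : T * (L * (3 / 8 * G) / (2 * (S * G / R))) = R * S / 32 := by
    have : (L : ℝ) * T = S ^ 2 / 6 := by linarith
    calc T * (L * (3 / 8 * G) / (2 * (S * G / R))) = 3 / 16 * R * (L * T) / S := by
          field_simp; ring
      _ = _ := by rw [this]; field_simp; ring
  -- Here `11/2 = 4 * (3/8) + 4` and `5/64 = (4 * (3/8) + 1) / 32`. The claim then follows with room
  -- to spare from `1 + 5/64 ≤ 2` and `11/2 ≤ 13`.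
  have hlhs : n * (S * G / R * R ^ 2) + T * (n * (3 / 8 * G * (4 * R / √L
        + 4 * (L * (3 / 8 * G) / (2 * (S * G / R))))
        + G * (4 * R / √L + L * (3 / 8 * G) / (2 * (S * G / R)))))
      = n * G * R * (S + 11 / 2 * (T / √L) + 5 / 64 * S) := by
    have e1 : S * G / R * R ^ 2 = S * G * R := by field_simp
    rw [e1]
    calc _ = n * (S * G * R) + n * G * R * (11 / 2 * (T / √L))
          + n * G * (5 / 2 * (T * (L * (3 / 8 * G) / (2 * (S * G / R))))) := by ring
      _ = _ := by rw [he]; ring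
  rw [hlhs]
  have hrhs : 2 * n * G * R * √(6 * T * C) + (4 * √3 + 13) * n * G * R * a
    = n * G * R * (2 * (√(6 * T * C) + 2 * √3 * a) + 13 * a) := by ring
  rw [hrhs]
  refine mul_le_mul_of_nonneg_left ?_ (by positivity)
  linarith

end Tuning

/-! ### Simplification of the bound to a rate -/

section Rate

variable {n : ℕ} {𝒢 : SimpleGraph (Fin n)} {A : Matrix (Fin n) (Fin n) ℝ}

theorem commC_le (hA : IsCommMatrix 𝒢 A) (hn : 0 < n) :
    (commC A : ℝ) ≤ 7 / 4 * Real.log (14 * n) / √(gap A) + 1 := by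
  have hn1 : (1 : ℝ) ≤ n := by exact_mod_cast hn
  have hx0 : 0 < √(gap A) := Real.sqrt_pos.2 (by unfold gap; linarith [hA.sigma_lt])
  have hlog0 : 0 ≤ Real.log (14 * n) := Real.log_nonneg (by linarith)
  have h2 : √2 ^ 2 = 2 := Real.sq_sqrt (by norm_num)
  have h20 : 0 ≤ √2 := Real.sqrt_nonneg 2
  have h21 : 7 / 5 ≤ √2 := by nlinarith
  have hC : √2 * Real.log (√(14 * (n : ℝ))) / ((√2 - 1) * √(gap A))
      ≤ 7 / 4 * Real.log (14 * n) / √(gap A) := by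
    rw [Real.log_sqrt (by positivity), div_le_div_iff₀ (mul_pos (by linarith) hx0) hx0]
    have h3 : √2 * (Real.log (14 * n) / 2) ≤ 7 / 4 * Real.log (14 * n) * (√2 - 1) := by nlinarith
    calc _ ≤ 7 / 4 * Real.log (14 * n) * (√2 - 1) * √(gap A) := by gcongr
      _ = _ := by ring
  have h0 : 0 ≤ √2 * Real.log (√(14 * (n : ℝ))) / ((√2 - 1) * √(gap A)) := by
    have : 0 ≤ √2 - 1 := by linarith
    rw [Real.log_sqrt (by positivity)]
    positivity
  have := (Nat.ceil_lt_add_one h0).le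
  unfold commC
  linarith

theorem two_mul_sqrt_commC_le (hA : IsCommMatrix 𝒢 A) (hn : 0 < n) (T : ℕ) :
    2 * √(6 * T * commC A) ≤ 20 * (T : ℝ) ^ (3 / 4 : ℝ)
      + 40 * (gap A ^ (-(1 / 4) : ℝ) * √(T * Real.log n)) := by
  have hC := commC_le hA hn
  have hg0 : 0 < gap A := by unfold gap; linarith [hA.sigma_lt]
  have hT0 : (0 : ℝ) ≤ T := Nat.cast_nonneg T
  have hsq := sqrt_le_rpow_three_quarters T
  rcases Nat.lt_or_ge 1 n with h1 | h1
  · have hn2 : (2 : ℝ) ≤ n := by exact_mod_cast h1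
    have hl2 : Real.log 2 ≤ Real.log n := Real.log_le_log (by norm_num) hn2
    have hlog2 := Real.log_two_gt_d9
    have hl14 : Real.log 14 ≤ 4 * Real.log 2 := by
      rw [show (4 : ℝ) * Real.log 2 = Real.log (2 ^ 4) by rw [Real.log_pow]; norm_num]
      exact Real.log_le_log (by norm_num) (by norm_num)
    rw [Real.log_mul (by norm_num) (by positivity)] at hC
    set x := √(gap A) with hx
    have hx0 : 0 < x := Real.sqrt_pos.2 hg0
    have hx1 : x ≤ 1 := by
      rw [hx, Real.sqrt_le_one]; unfold gap; linarith [sigma2_nonneg A]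
    -- `log (14 n) ≤ 5 log n` for `n ≥ 2`, and the `1` from rounding is absorbed using `x ≤ 1` and
    -- `log n ≥ log 2`.
    have hC2 : (commC A : ℝ) ≤ 12 * Real.log n / x := by
      refine hC.trans ?_
      rw [div_add_one hx0.ne']
      gcongr
      linarith
    have hsqr : (gap A ^ (-(1 / 4) : ℝ)) ^ 2 = 1 / x := by
      have hinv : 1 / x = gap A ^ (-(1 / 2) : ℝ) := by
        rw [hx, Real.sqrt_eq_rpow, Real.rpow_neg hg0.le, one_div]
      rw [hinv, ← Real.rpow_natCast, ← Real.rpow_mul hg0.le]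
      norm_num
    have key : 2 * √(6 * T * commC A) ≤ 40 * (gap A ^ (-(1 / 4) : ℝ) * √(T * Real.log n)) := by
      refine abs_le_of_sq_le_sq' ?_ (by positivity) |>.2
      rw [mul_pow, mul_pow, mul_pow, hsqr, Real.sq_sqrt (by positivity),
        Real.sq_sqrt (mul_nonneg hT0 (by linarith))]
      have h3 : (T : ℝ) * commC A ≤ T * (12 * Real.log n / x) := by gcongr
      have e : (T : ℝ) * (12 * Real.log n / x) = 12 * (1 / x * (T * Real.log n)) := by ring
      have h4 : 0 ≤ 1 / x * (T * Real.log n) :=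
        mul_nonneg (by positivity) (mul_nonneg hT0 (by linarith))
      rw [e] at h3
      nlinarith
    have : 0 ≤ 20 * (T : ℝ) ^ (3 / 4 : ℝ) := by positivity
    linarith
  -- Now `log n = 0`, so the whole term must fit into `20 T^(3/4)`. This works because the gap is
  -- one and `C` is bounded by a constant.
  · obtain rfl : n = 1 := by omega
    have hσ : sigma2 A = 0 := LinearMap.singularValues_of_finrank_le _ (by simp)
    have hg : gap A = 1 := by simp [gap, hσ]
    have hlog14 : Real.log 14 ≤ 3 := by
      have h7 := Real.log_two_lt_d9
      have : Real.log 14 ≤ Real.log (2 ^ 4) := Real.log_le_log (by norm_num) (by norm_num)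
      rw [Real.log_pow] at this
      norm_num at this
      linarith
    simp only [hg, Nat.cast_one, mul_one, Real.sqrt_one, div_one] at hC
    have hC' : (commC A : ℝ) ≤ 16 := by linarith
    have key : √(6 * T * commC A) ≤ 10 * √T := by
      refine abs_le_of_sq_le_sq' ?_ (by positivity) |>.2
      rw [mul_pow, Real.sq_sqrt (by positivity), Real.sq_sqrt hT0]
      have : (T : ℝ) * commC A ≤ T * 16 := by gcongr
      linarith
    simp only [Nat.cast_one, Real.log_one, mul_zero, Real.sqrt_zero]
    linarith

theorem bound_le_rate (hA : IsCommMatrix 𝒢 A) (hn : 0 < n) (T : ℕ) {G R : ℝ}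
    (hGR : 0 ≤ G * R) :
    2 * n * G * R * √(6 * T * commC A) + (4 * √3 + 13) * n * G * R * (T : ℝ) ^ (3 / 4 : ℝ)
      ≤ 40 * (G * R) * (n * (T : ℝ) ^ (3 / 4 : ℝ)
        + n * gap A ^ (-(1 / 4) : ℝ) * √(T * Real.log n)) := by
  have h1 := two_mul_sqrt_commC_le hA hn T
  have h3 : √3 ≤ 7 / 4 := by
    rw [Real.sqrt_le_left (by norm_num)]; norm_num
  set a := (T : ℝ) ^ (3 / 4 : ℝ)
  have ha : 0 ≤ a := by positivity
  have h4 : √3 * a ≤ 7 / 4 * a := by gcongr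
  have h5 : 0 ≤ G * R * n := by positivity
  calc _ = G * R * n * (2 * √(6 * T * commC A) + (4 * (√3 * a) + 13 * a)) := by ring
    _ ≤ G * R * n * (40 * a + 40 * (gap A ^ (-(1 / 4) : ℝ) * √(T * Real.log n))) := by
        refine mul_le_mul_of_nonneg_left ?_ h5
        linarith
    _ = _ := by ring

end Rate

/-! ### Linear regret with tuned parameters, including degenerate cases -/

section Tuned

variable {d n : ℕ} {K : Set (Vec d)} {R G : ℝ} {𝒢 : SimpleGraph (Fin n)}
  {A : Matrix (Fin n) (Fin n) ℝ}

theorem tuned_linear_regret_le (hK : IsDecisionSet K R) (hR : 0 ≤ R) (hG : 0 ≤ G)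
    (hA : IsCommMatrix 𝒢 A) (hn : 0 < n) {T N : ℕ} (hN : commC A ≤ N) {lo : Vec d → Vec d}
    (hlo : IsLinearOracle K lo) {x₀ : Vec d} (hx₀ : IsArgmin (fun x => ‖x‖) K x₀)
    {c : Losses d n} (hc : ∀ t i, ‖c t i‖ ≤ 3 / 8 * G) (hcT : ∀ t, T ≤ t → c t = 0)
    (i : Fin n) {y : Vec d} (hy : y ∈ K) :
    ∑ t ∈ Finset.range T, ∑ j, (⟪c t j, (tunedParams A T G R N lo x₀).alg t c j - y⟫
        + G / 2 * ‖(tunedParams A T G R N lo x₀).alg t c i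
          - (tunedParams A T G R N lo x₀).alg t c j‖)
      ≤ 2 * n * G * R * √(6 * T * commC A)
        + (4 * √3 + 13) * n * G * R * (T : ℝ) ^ (3 / 4 : ℝ) := by
  set p := tunedParams A T G R N lo x₀ with hp
  have hnn : 0 ≤ 2 * n * G * R * √(6 * T * commC A)
        + (4 * √3 + 13) * n * G * R * (T : ℝ) ^ (3 / 4 : ℝ) := by positivity
  -- The general bound needs `h > 0`, so `T = 0`, `G = 0` (all losses vanish) and `R = 0` (all
  -- points of `K` are zero) are treated separately.
  rcases Nat.eq_zero_or_pos T with rfl | hT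
  · simpa only [Finset.range_zero, Finset.sum_empty] using hnn
  rcases hG.eq_or_lt with rfl | hG
  · have h0 : ∀ t j, c t j = 0 := fun t j => norm_le_zero_iff.1 (by simpa using hc t j)
    simp [h0]
  rcases hR.eq_or_lt with rfl | hR
  · have h0 : ∀ x ∈ K, x = 0 := fun x hx => norm_le_zero_iff.1 (hK.norm_le x hx)
    have h1 : ∀ t j, p.alg t c j = 0 := fun t j =>
      h0 _ (ADFTRLParams.primal_mem hK.convex hlo hx₀.1 _ _)
    simp [h1, h0 y hy]
  have hL : 0 < p.L := by
    have : 0 < ⌈√(T : ℝ)⌉₊ := Nat.ceil_pos.2 (Real.sqrt_pos.2 (by exact_mod_cast hT))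
    exact lt_of_lt_of_le this (le_max_left _ _)
  have hL' : 0 < (p.L : ℝ) := by exact_mod_cast hL
  have hh : 0 < p.h := by
    change 0 < √(6 * (p.L : ℝ) * T) * G / R
    have hT' : (0 : ℝ) < T := by exact_mod_cast hT
    positivity
  exact (ADFTRLParams.linear_regret_le (p := p) hK hR.le hA hn rfl hN hh hL hlo hx₀
    (by positivity) hG.le hc hcT i hy).trans (tuned_bound_le hG hR hT rfl)

end Tuned

/-! ### Causality and measurability of the algorithm -/

section Causality

variable {d n : ℕ}

namespace ADFTRLParams

variable (p : ADFTRLParams d n) {c c' : Losses d n}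

theorem blockGrad_congr {q : ℕ} (h : ∀ s < (q + 1) * p.L, c s = c' s) :
    p.blockGrad c q = p.blockGrad c' q := by
  ext1 i
  refine Finset.sum_congr rfl fun s hs => ?_
  rw [h]
  rw [Nat.succ_mul]
  exact Nat.add_lt_add_left (Finset.mem_range.1 hs) _

theorem dual_congr : ∀ {q : ℕ}, (∀ s < q * p.L, c s = c' s) → p.dual c q = p.dual c' q
  | 0, _ => rfl
  | q + 1, h => by
    rw [dual, dual, p.blockGrad_congr h, dual_congr (q := q) fun s hs =>
      h s (hs.trans_le (Nat.mul_le_mul_right _ q.le_succ))]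

theorem primal_congr : ∀ {q : ℕ}, (∀ s < q * p.L, c s = c' s) → p.primal c q = p.primal c' q
  | 0, _ => rfl
  | 1, _ => rfl
  | q + 2, h => by
    rw [primal, primal, p.dual_congr (q := q) fun s hs =>
        h s (hs.trans_le (Nat.mul_le_mul_right _ (by omega))),
      primal_congr (q := q + 1) fun s hs =>
        h s (hs.trans_le (Nat.mul_le_mul_right _ (by omega)))]

theorem alg_congr {t : ℕ} (h : ∀ s < t, c s = c' s) : p.alg t c = p.alg t c' := by
  unfold alg
  rw [p.primal_congr fun s hs => h s (hs.trans_le (Nat.div_mul_le_self t p.L))]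

theorem measurable_blockGrad (q : ℕ) : Measurable fun c : Losses d n => p.blockGrad c q := by
  unfold blockGrad
  fun_prop

theorem measurable_gossipStep (A : Matrix (Fin n) (Fin n) ℝ) (θ : ℝ) :
    Measurable (gossipStep (d := d) A θ) := by
  unfold gossipStep
  fun_prop

theorem measurable_dual : ∀ q, Measurable fun c : Losses d n => p.dual c q
  | 0 => by simp only [dual]; fun_prop
  | q + 1 => by
    have h1 := measurable_dual q
    have h2 := p.measurable_blockGrad q
    have h3 : Measurable (gossipStep (d := d) p.A p.θ)^[p.N] :=
      (measurable_gossipStep p.A p.θ).iterate _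
    simp only [dual]
    exact h3.comp ((h1.fst.add h2).prodMk (h1.snd.add h2))

theorem measurable_cgStep {lo : Vec d → Vec d} (hlo : Measurable lo) (h : ℝ) :
    Measurable fun w : Vec d × Vec d => cgStep lo h w.1 w.2 := by
  have hg : Measurable fun w : Vec d × Vec d => ftrlGrad h w.1 w.2 := by
    unfold ftrlGrad; fun_prop
  unfold cgStep lineSearch
  fun_prop

theorem measurable_cgStep_iterate {lo : Vec d → Vec d} (hlo : Measurable lo) (h : ℝ) (k : ℕ) :
    Measurable fun w : Vec d × Vec d => (cgStep lo h w.1)^[k] w.2 := by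
  induction k with
  | zero => exact measurable_snd
  | succ k ih =>
    simp only [Function.iterate_succ_apply']
    exact (measurable_cgStep hlo h).comp (measurable_fst.prodMk ih)

theorem measurable_primal (hlo : Measurable p.lo) (q : ℕ) (i : Fin n) :
    Measurable fun c : Losses d n => p.primal c q i := by
  induction q using Nat.twoStepInduction with
  | zero => simp only [primal]; fun_prop
  | one => simp only [primal]; fun_prop
  | more q _ ih =>
    have h1 := (measurable_cgStep_iterate hlo p.h p.L).comp
      ((measurable_pi_iff.1 (p.measurable_dual q).fst i).prodMk ih)
    simp only [primal]
    simpa only [Function.comp_def] using h1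

theorem measurable_alg (hlo : Measurable p.lo) (t : ℕ) : Measurable (p.alg t) :=
  measurable_pi_lambda _ fun i => p.measurable_primal hlo _ i

end ADFTRLParams

end Causality

/-! ### The losses produced by a run -/

section SentLosses

variable {d n : ℕ} {Ω : Type*} (D : DOCOAlg d n) (xlow : Vec d) (z : ℕ → Fin n → Ω → ℝ)
  (sg : ℕ → Fin n → Vec d → Ω → Vec d) (ω : Ω)

theorem sentLosses_of_le {s t : ℕ} (h : t ≤ s) : sentLosses D xlow z sg ω t s = 0 := by
  induction t with
  | zero => rfl
  | succ t ih =>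
    rw [sentLosses, Function.update_of_ne (by omega), ih (by omega)]

theorem sentLosses_of_lt {s t : ℕ} (h : s < t) :
    sentLosses D xlow z sg ω t s = fun i => -((3 / 8 : ℝ) • sg s i
        (queryPoint xlow (z s i ω) (prepDecision D xlow z sg s i ω)) ω) := by
  induction t with
  | zero => omega
  | succ t ih =>
    rcases Nat.lt_succ_iff_lt_or_eq.1 h with h | rfl
    · rw [sentLosses, Function.update_of_ne h.ne, ih h]
    · rw [sentLosses, Function.update_self]; rfl

/-- Causality replaces the growing loss sequence by the final one, so that the pathwise regret bound
for a fixed sequence applies to the adaptive run. -/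
theorem prepDecision_eq (hD : ∀ t c c', (∀ s < t, c s = c' s) → D t c = D t c') {t T : ℕ}
    (h : t ≤ T) (i : Fin n) :
    prepDecision D xlow z sg t i ω = D t (sentLosses D xlow z sg ω T) i := by
  unfold prepDecision
  rw [hD t _ (sentLosses D xlow z sg ω T) fun s hs => by
    rw [sentLosses_of_lt _ _ _ _ _ hs, sentLosses_of_lt _ _ _ _ _ (hs.trans_le h)]]

end SentLosses

/-! ### Functions controlled only on the cube -/

section CubeFunctions

variable {d : ℕ} {Ω : Type*} [MeasurableSpace Ω] {f : Vec d → ℝ}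

/-- Nothing is known about `f` off the cube; its extension by zero is a globally measurable
substitute. -/
theorem measurable_piecewise_cube (hf : ContinuousOn f (cube d)) [∀ x, Decidable (x ∈ cube d)] :
    Measurable ((cube d).piecewise f 0) :=
  hf.measurable_piecewise continuous_zero.continuousOn isClosed_cube.measurableSet

theorem measurable_comp_of_mem_cube (hf : ContinuousOn f (cube d)) {X : Ω → Vec d}
    (hX : Measurable X) (hXm : ∀ ω, X ω ∈ cube d) : Measurable fun ω => f (X ω) := by
  classical
  have : (fun ω => f (X ω)) = (cube d).piecewise f 0 ∘ X := by
    ext ω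
    exact (Set.piecewise_eq_of_mem _ _ _ (hXm ω)).symm
  rw [this]
  exact (measurable_piecewise_cube hf).comp hX

theorem exists_bound_on_cube (hf : ContinuousOn f (cube d)) : ∃ M, ∀ x ∈ cube d, ‖f x‖ ≤ M :=
  isCompact_cube.exists_bound_of_continuousOn hf

theorem integrable_comp_of_mem_cube {P : Measure Ω} [IsFiniteMeasure P]
    (hf : ContinuousOn f (cube d)) {X : Ω → Vec d} (hX : Measurable X)
    (hXm : ∀ ω, X ω ∈ cube d) : Integrable (fun ω => f (X ω)) P := by
  obtain ⟨M, hM⟩ := exists_bound_on_cube hf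
  exact Integrable.of_bound (measurable_comp_of_mem_cube hf hX hXm).aestronglyMeasurable M
    (ae_of_all _ fun ω => hM _ (hXm ω))

theorem norm_sub_le_of_norm_gradientWithin_le (hf : DifferentiableOn ℝ f (cube d)) {G : ℝ}
    (hG : ∀ x ∈ cube d, ‖gradientWithin f (cube d) x‖ ≤ G) {x y : Vec d} (hx : x ∈ cube d)
    (hy : y ∈ cube d) : f y - f x ≤ G * ‖y - x‖ := by
  refine (le_abs_self _).trans (convex_cube.norm_image_sub_le_of_norm_fderivWithin_le hf
    (fun x hx => ?_) hx hy)
  rw [← toDual_gradientWithin, LinearIsometryEquiv.norm_map]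
  exact hG x hx

end CubeFunctions

/-! ### Averaging over an independent boosting sample -/

section BoostedGradient

variable {d : ℕ} {f : Vec d → ℝ}

/-- The gradient is not assumed continuous, so the inner product is exhibited as a limit of
difference quotients. With `q` the query point, `y - x = (y - q) - (x - q)` uses only directions
along which small steps from `q` stay in the cube. -/
theorem aemeasurable_inner_gradientWithin (hf : DifferentiableOn ℝ f (cube d)) {xlow y : Vec d}
    (hl : xlow ∈ cube d) (hy : y ∈ cube d) {ν : Measure (Vec d × ℝ)}
    (hν : ∀ᵐ w ∂ν, w.1 ∈ cube d ∧ w.2 ∈ Set.Icc (0 : ℝ) 1) :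
    AEMeasurable (fun w : Vec d × ℝ =>
      ⟪gradientWithin f (cube d) (queryPoint xlow w.2 w.1), y - w.1⟫) ν := by
  classical
  set F := (cube d).piecewise f 0 with hF
  have hFm : Measurable F := measurable_piecewise_cube hf.continuousOn
  have hFeq : ∀ x ∈ cube d, F x = f x := fun x hx => Set.piecewise_eq_of_mem _ _ _ hx
  have hq : Measurable fun w : Vec d × ℝ => queryPoint xlow w.2 w.1 := by
    unfold queryPoint; fun_prop
  have hlim : ∀ q ∈ cube d, ∀ x ∈ cube d, Filter.Tendsto
      (fun m : ℕ => (m : ℝ) * (F (q + (1 / m : ℝ) • (x - q)) - F q)) Filter.atTop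
      (nhds ⟪gradientWithin f (cube d) q, x - q⟫) := by
    intro q hq x hx
    refine (IsDRReward.tendsto_mul_sub hf hq (v := x - q) (by simpa using hx)).congr' ?_
    filter_upwards [Filter.eventually_gt_atTop 0] with m hm
    have hm' : (1 : ℝ) ≤ m := by exact_mod_cast hm
    rw [hFeq q hq, hFeq]
    exact add_smul_sub_mem convex_cube hq hx
      ⟨by positivity, (div_le_one (by linarith)).2 hm'⟩
  refine aemeasurable_of_tendsto_metrizable_ae' (f := fun (m : ℕ) (w : Vec d × ℝ) =>
    (m : ℝ) * (F (queryPoint xlow w.2 w.1 + (1 / m : ℝ) • (y - queryPoint xlow w.2 w.1))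
      - F (queryPoint xlow w.2 w.1))
    - (m : ℝ) * (F (queryPoint xlow w.2 w.1 + (1 / m : ℝ) • (w.1 - queryPoint xlow w.2 w.1))
      - F (queryPoint xlow w.2 w.1))) (fun m => ?_) ?_
  · have h1 : Measurable fun w : Vec d × ℝ =>
      F (queryPoint xlow w.2 w.1 + (1 / m : ℝ) • (y - queryPoint xlow w.2 w.1)) :=
      hFm.comp (by fun_prop)
    have h2 : Measurable fun w : Vec d × ℝ =>
      F (queryPoint xlow w.2 w.1 + (1 / m : ℝ) • (w.1 - queryPoint xlow w.2 w.1)) :=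
      hFm.comp (by fun_prop)
    have h3 : Measurable fun w : Vec d × ℝ => F (queryPoint xlow w.2 w.1) := hFm.comp hq
    exact (((h1.sub h3).const_mul _).sub ((h2.sub h3).const_mul _)).aemeasurable
  · filter_upwards [hν] with w hw
    have hqw := queryPoint_mem convex_cube hl hw.1 hw.2
    have := (hlim _ hqw y hy).sub (hlim _ hqw w.1 hw.1)
    rwa [← inner_sub_right, sub_sub_sub_cancel_right] at this

theorem exists_norm_sub_le_of_mem_cube (d : ℕ) :
    ∃ M, 0 ≤ M ∧ ∀ x ∈ cube d, ∀ y ∈ cube d, ‖x - y‖ ≤ M := by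
  obtain ⟨M, hM⟩ := isCompact_cube.isBounded.exists_norm_le (E := Vec d)
  refine ⟨M + M, ?_, fun x hx y hy => (norm_sub_le _ _).trans (add_le_add (hM x hx) (hM y hy))⟩
  have := (norm_nonneg _).trans (hM 0 zero_mem_cube)
  linarith

variable {Ω : Type*} [mΩ : MeasurableSpace Ω] {P : Measure Ω} [IsProbabilityMeasure P]

/-- By independence the joint law is a product, and Fubini reduces the claim to the inequality for a
fixed decision `x`. -/
theorem IsDRReward.le_integral_of_indepFun (hf : IsDRReward f) {G : ℝ}
    (hG : ∀ x ∈ cube d, ‖gradientWithin f (cube d) x‖ ≤ G) {xlow y : Vec d}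
    (hl : xlow ∈ cube d) (hy : y ∈ cube d) {X : Ω → Vec d} {Z : Ω → ℝ} (hX : Measurable X)
    (hXm : ∀ ω, X ω ∈ cube d) (hZ : Measurable Z) (hZm : ∀ ω, Z ω ∈ Set.Icc (0 : ℝ) 1)
    (hlaw : P.map Z = boostingLaw) (hind : IndepFun X Z P) :
    (1 - supNorm xlow) / 4 * f y - ∫ ω, f ((1 / 2 : ℝ) • (X ω + xlow)) ∂P ≤
      ∫ ω, (3 / 8 : ℝ) * ⟪gradientWithin f (cube d) (queryPoint xlow (Z ω) (X ω)), y - X ω⟫ ∂P := by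
  obtain ⟨M, hM0, hM⟩ := exists_norm_sub_le_of_mem_cube d
  set H : Vec d × ℝ → ℝ := fun w =>
    (3 / 8 : ℝ) * ⟪gradientWithin f (cube d) (queryPoint xlow w.2 w.1), y - w.1⟫ with hH
  have hXZ : Measurable fun ω => (X ω, Z ω) := hX.prodMk hZ
  have hset : MeasurableSet {w : Vec d × ℝ | w.1 ∈ cube d ∧ w.2 ∈ Set.Icc (0 : ℝ) 1} :=
    (measurable_fst isClosed_cube.measurableSet).inter (measurable_snd measurableSet_Icc)
  have hae : ∀ᵐ w ∂(P.map fun ω => (X ω, Z ω)), w.1 ∈ cube d ∧ w.2 ∈ Set.Icc (0 : ℝ) 1 :=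
    (ae_map_iff hXZ.aemeasurable hset).2 (ae_of_all _ fun ω => ⟨hXm ω, hZm ω⟩)
  have hHm : AEMeasurable H (P.map fun ω => (X ω, Z ω)) :=
    (aemeasurable_inner_gradientWithin hf.differentiableOn hl hy hae).const_mul _
  have hprod : P.map (fun ω => (X ω, Z ω)) = (P.map X).prod boostingLaw := by
    rw [← hlaw]
    exact hind.map_prod_eq_prod_map_map hX.aemeasurable hZ.aemeasurable
  have hG0 : 0 ≤ G := (norm_nonneg _).trans (hG 0 zero_mem_cube)
  have : IsProbabilityMeasure (P.map fun ω => (X ω, Z ω)) :=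
    Measure.isProbabilityMeasure_map hXZ.aemeasurable
  have : IsProbabilityMeasure (P.map X) := Measure.isProbabilityMeasure_map hX.aemeasurable
  have : IsProbabilityMeasure boostingLaw :=
    hlaw ▸ Measure.isProbabilityMeasure_map hZ.aemeasurable
  have hHint : Integrable H (P.map fun ω => (X ω, Z ω)) := by
    refine Integrable.of_bound hHm.aestronglyMeasurable (3 / 8 * (G * M)) ?_
    filter_upwards [hae] with w hw
    rw [hH, norm_mul, Real.norm_of_nonneg (by norm_num : (0 : ℝ) ≤ 3 / 8)]
    refine mul_le_mul_of_nonneg_left ((norm_inner_le_norm _ _).trans ?_) (by norm_num)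
    exact mul_le_mul (hG _ (queryPoint_mem convex_cube hl hw.1 hw.2)) (hM y hy _ hw.1)
      (norm_nonneg _) hG0
  have h1 : ∫ ω, H (X ω, Z ω) ∂P = ∫ x, ∫ u, H (x, u) ∂boostingLaw ∂(P.map X) := by
    rw [← integral_map hXZ.aemeasurable hHm.aestronglyMeasurable, hprod, integral_prod]
    rwa [← hprod]
  have hcont := hf.differentiableOn.continuousOn
  classical
  set F := (cube d).piecewise f 0 with hF
  have hFm : Measurable F := measurable_piecewise_cube hcont
  have hFeq : ∀ x ∈ cube d, F x = f x := fun x hx => Set.piecewise_eq_of_mem _ _ _ hx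
  have hhalf : ∀ x ∈ cube d, (1 / 2 : ℝ) • (x + xlow) ∈ cube d := fun x hx => by
    rw [← queryPoint_one]
    exact queryPoint_mem convex_cube hl hx (by simp)
  have hFm2 : Measurable fun x : Vec d => F ((1 / 2 : ℝ) • (x + xlow)) := hFm.comp (by fun_prop)
  have h2 : ∫ ω, f ((1 / 2 : ℝ) • (X ω + xlow)) ∂P
      = ∫ x, F ((1 / 2 : ℝ) • (x + xlow)) ∂(P.map X) := by
    rw [integral_map hX.aemeasurable hFm2.aestronglyMeasurable]
    exact integral_congr_ae (ae_of_all _ fun ω => (hFeq _ (hhalf _ (hXm ω))).symm)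
  have haeX : ∀ᵐ x ∂(P.map X), x ∈ cube d :=
    (ae_map_iff hX.aemeasurable isClosed_cube.measurableSet).2 (ae_of_all _ hXm)
  have hFint : Integrable (fun x => F ((1 / 2 : ℝ) • (x + xlow))) (P.map X) := by
    obtain ⟨C, hC⟩ := exists_bound_on_cube hcont
    refine Integrable.of_bound hFm2.aestronglyMeasurable C ?_
    filter_upwards [haeX] with x hx
    rw [hFeq _ (hhalf x hx)]
    exact hC _ (hhalf x hx)
  rw [hprod] at hHint
  change _ ≤ ∫ ω, H (X ω, Z ω) ∂P
  rw [h1, h2]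
  have h3 : (1 - supNorm xlow) / 4 * f y - ∫ x, F ((1 / 2 : ℝ) • (x + xlow)) ∂(P.map X)
      = ∫ x, ((1 - supNorm xlow) / 4 * f y - F ((1 / 2 : ℝ) • (x + xlow))) ∂(P.map X) := by
    rw [integral_sub (integrable_const _) hFint, integral_const]
    simp
  rw [h3]
  refine integral_mono_ae ((integrable_const _).sub hFint) hHint.integral_prod_left ?_
  filter_upwards [haeX, hHint.prod_right_ae] with x hx hxi
  rw [hFeq _ (hhalf x hx)]
  exact hf.le_integral_boostingLaw hl hx hy hxi

end BoostedGradient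

/-! ### From true to stochastic gradients -/

section PullOut

variable {d : ℕ} {f : Vec d → ℝ} {Ω : Type*} {m m' mΩ : MeasurableSpace Ω} {P : Measure Ω}
  [IsProbabilityMeasure P]

theorem IsDRReward.le_integral_inner_of_condExp (hf : IsDRReward f) {G : ℝ}
    (hG : ∀ x ∈ cube d, ‖gradientWithin f (cube d) x‖ ≤ G) {xlow y : Vec d}
    (hl : xlow ∈ cube d) (hy : y ∈ cube d) (hm' : m' ≤ mΩ)
    (hmm' : m ≤ m') {X : Ω → Vec d} {Z : Ω → ℝ} (hX : Measurable[m] X)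
    (hXm : ∀ ω, X ω ∈ cube d) (hZ : Measurable[m'] Z) (hZm : ∀ ω, Z ω ∈ Set.Icc (0 : ℝ) 1)
    (hlaw : P.map Z = boostingLaw) (hind : Indep (MeasurableSpace.comap Z inferInstance) m P)
    {S : Ω → Vec d} (hS : Measurable S) (hSG : ∀ ω, ‖S ω‖ ≤ G)
    (hSc : P[S | m'] =ᵐ[P] fun ω => gradientWithin f (cube d) (queryPoint xlow (Z ω) (X ω))) :
    (1 - supNorm xlow) / 4 * f y - ∫ ω, f ((1 / 2 : ℝ) • (X ω + xlow)) ∂P ≤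
      ∫ ω, ⟪-((3 / 8 : ℝ) • S ω), X ω - y⟫ ∂P := by
  obtain ⟨M, hM0, hM⟩ := exists_norm_sub_le_of_mem_cube d
  have hXm' : Measurable[m'] X := hX.mono hmm' le_rfl
  have hXΩ : Measurable X := hXm'.mono hm' le_rfl
  have hZΩ : Measurable Z := hZ.mono hm' le_rfl
  have hIF : IndepFun X Z P := by
    rw [IndepFun_iff_Indep]
    exact (indep_of_indep_of_le_right hind hX.comap_le).symm
  refine (hf.le_integral_of_indepFun hG hl hy hXΩ hXm hZΩ hZm hlaw hIF).trans (le_of_eq ?_)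
  have hSint : Integrable S P :=
    Integrable.of_bound hS.aestronglyMeasurable G (ae_of_all _ hSG)
  have hG0 : 0 ≤ G := (norm_nonneg _).trans (hG 0 zero_mem_cube)
  have hgm : Measurable[m'] fun ω => y - X ω := measurable_const.sub hXm'
  have hSX : Integrable (fun ω => innerSL ℝ (S ω) (y - X ω)) P := by
    refine Integrable.of_bound ?_ (G * M) (ae_of_all _ fun ω => ?_)
    · have : Measurable fun ω => ⟪S ω, y - X ω⟫ := hS.inner (measurable_const.sub hXΩ)
      exact this.aestronglyMeasurable
    · exact (norm_inner_le_norm _ _).trans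
        (mul_le_mul (hSG ω) (hM y hy _ (hXm ω)) (norm_nonneg _) hG0)
  -- `y - X` is known at query time, so it leaves the conditional expectation and `S` is replaced by
  -- the gradient at the query point.
  have hpull := condExp_bilin_of_stronglyMeasurable_right (innerSL ℝ) hgm.stronglyMeasurable
    hSX hSint
  have h1 : ∫ ω, ⟪S ω, y - X ω⟫ ∂P = ∫ ω, ⟪gradientWithin f (cube d)
      (queryPoint xlow (Z ω) (X ω)), y - X ω⟫ ∂P := by
    rw [← integral_condExp hm' (f := fun ω => ⟪S ω, y - X ω⟫)]
    refine integral_congr_ae ?_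
    filter_upwards [hpull, hSc] with ω h2 h3
    rw [h3] at h2
    exact h2
  rw [integral_const_mul, ← h1, ← integral_const_mul]
  refine integral_congr_ae (ae_of_all _ fun ω => ?_)
  simp only [inner_neg_left, inner_smul_left, inner_sub_right, RCLike.conj_to_real]
  ring

end PullOut

section Decision

variable {d n : ℕ} {Ω : Type*} {z : ℕ → Fin n → Ω → ℝ} {sg : ℕ → Fin n → Vec d → Ω → Vec d}
  {D : DOCOAlg d n} {xlow : Vec d}

theorem decision_mem_cube (hDK : ∀ t c i, D t c i ∈ cube d) (hl : xlow ∈ cube d) (t : ℕ)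
    (i : Fin n) (ω : Ω) : decision D xlow z sg t i ω ∈ cube d := by
  unfold decision
  rw [← queryPoint_one]
  exact queryPoint_mem convex_cube hl (hDK _ _ _) (by simp)

end Decision

section MeasurableLosses

variable {d n : ℕ} {Ω : Type*} {m : MeasurableSpace Ω}

theorem measurable_losses_iff {c : Ω → Losses d n} :
    Measurable c ↔ ∀ t i, Measurable fun ω => c ω t i := by
  simp only [measurable_pi_iff]

end MeasurableLosses

/-! ### Adapted runs and the reduction to linear losses -/

section Run

variable {d n : ℕ} {Ω : Type*} [mΩ : MeasurableSpace Ω] {P : Measure Ω}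
  {ℱ : Filtration ℕ mΩ} {T : ℕ} {z : ℕ → Fin n → Ω → ℝ}
  {f : ℕ → Fin n → Vec d → ℝ} {G : ℝ} {sg : ℕ → Fin n → Vec d → Ω → Vec d}

theorem IsBoostingSample.queryInfo_le (hz : IsBoostingSample P ℱ T z) {t : ℕ} (ht : t < T)
    (i : Fin n) : queryInfo ℱ z t i ≤ mΩ :=
  sup_le (ℱ.le t) (((hz.measurable t ht i).comap_le).trans (ℱ.le _))

/-- For a constant query point, taking expectations in the unbiasedness identity expresses the
gradient as a mean of vectors of norm at most `G`. -/
theorem IsStochasticGradient.norm_gradientWithin_le [IsProbabilityMeasure P]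
    (hsg : IsStochasticGradient P ℱ T z f G sg)
    (hz : IsBoostingSample P ℱ T z) {t : ℕ} (ht : t < T) (i : Fin n) {x : Vec d}
    (hx : x ∈ cube d) : ‖gradientWithin (f t i) (cube d) x‖ ≤ G := by
  have h1 := hsg.unbiased t ht i (fun _ => x) measurable_const fun _ => hx
  have h2 := integral_condExp (hz.queryInfo_le ht i) (f := fun ω => sg t i x ω) (μ := P)
  rw [integral_congr_ae h1, integral_const] at h2
  simp only [probReal_univ, one_smul] at h2
  rw [h2]
  simpa using norm_integral_le_of_norm_le_const (μ := P) (f := fun ω => sg t i x ω)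
    (ae_of_all _ (hsg.bounded t ht i x hx))

variable {D : DOCOAlg d n} {K : Set (Vec d)} {xlow : Vec d}

theorem measurable_prepDecision_of_sentLosses (hDm : ∀ t, Measurable (D t)) {t : ℕ}
    (h : Measurable[ℱ t] fun ω => sentLosses D xlow z sg ω t) (i : Fin n) :
    Measurable[ℱ t] (prepDecision D xlow z sg t i) :=
  (measurable_pi_apply i).comp ((hDm t).comp h)

theorem queryPoint_prepDecision_measurable {t : ℕ} {i : Fin n}
    (h : Measurable[ℱ t] (prepDecision D xlow z sg t i)) :
    Measurable[queryInfo ℱ z t i] fun ω =>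
      queryPoint xlow (z t i ω) (prepDecision D xlow z sg t i ω) := by
  have h1 : Measurable[queryInfo ℱ z t i] (prepDecision D xlow z sg t i) :=
    h.mono le_sup_left le_rfl
  have h2 : Measurable[queryInfo ℱ z t i] (z t i) :=
    (comap_measurable (z t i)).mono le_sup_right le_rfl
  unfold queryPoint
  exact ((h2.div_const 2).smul (h1.sub_const xlow)).add_const xlow

theorem measurable_sentLosses (hsg : IsStochasticGradient P ℱ T z f G sg)
    (hz : IsBoostingSample P ℱ T z) (hDm : ∀ t, Measurable (D t))
    (hDK : ∀ t c i, D t c i ∈ cube d) (hl : xlow ∈ cube d) {t : ℕ} (ht : t ≤ T) :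
    Measurable[ℱ t] fun ω => sentLosses D xlow z sg ω t := by
  induction t with
  | zero => exact measurable_const
  | succ t ih =>
    have ih := ih (by omega)
    refine measurable_losses_iff.2 fun s i => ?_
    by_cases hs : s = t
    · subst hs
      simp only [sentLosses, Function.update_self]
      exact ((hsg.measurable s ht i _ (queryPoint_prepDecision_measurable
        (measurable_prepDecision_of_sentLosses hDm ih i))
        fun ω => queryPoint_mem convex_cube hl (hDK _ _ _) (hz.mem s ht i ω)).const_smul
          (3 / 8 : ℝ)).neg
    · simp only [sentLosses, Function.update_of_ne hs]
      exact (measurable_losses_iff.1 ih s i).mono (ℱ.mono t.le_succ) le_rfl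

theorem measurable_prepDecision (hsg : IsStochasticGradient P ℱ T z f G sg)
    (hz : IsBoostingSample P ℱ T z) (hDm : ∀ t, Measurable (D t))
    (hDK : ∀ t c i, D t c i ∈ cube d) (hl : xlow ∈ cube d) {t : ℕ} (ht : t ≤ T) (i : Fin n) :
    Measurable[ℱ t] (prepDecision D xlow z sg t i) :=
  measurable_prepDecision_of_sentLosses hDm (measurable_sentLosses hsg hz hDm hDK hl ht) i

theorem norm_sentLosses_le (hG : 0 ≤ G) (hsg : IsStochasticGradient P ℱ T z f G sg)
    (hz : IsBoostingSample P ℱ T z) (hDK : ∀ t c i, D t c i ∈ cube d) (hl : xlow ∈ cube d)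
    (ω : Ω) (t : ℕ) (i : Fin n) : ‖sentLosses D xlow z sg ω T t i‖ ≤ 3 / 8 * G := by
  rcases Nat.lt_or_ge t T with h | h
  · rw [sentLosses_of_lt _ _ _ _ _ h, norm_neg, norm_smul, Real.norm_of_nonneg (by norm_num)]
    exact mul_le_mul_of_nonneg_left (hsg.bounded t h i _ (queryPoint_mem convex_cube hl
      (hDK _ _ _) (hz.mem t h i ω)) ω) (by norm_num)
  · rw [sentLosses_of_le _ _ _ _ _ h]
    simpa using hG

theorem measurable_decision (hsg : IsStochasticGradient P ℱ T z f G sg)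
    (hz : IsBoostingSample P ℱ T z) (hDm : ∀ t, Measurable (D t))
    (hDK : ∀ t c i, D t c i ∈ cube d) (hl : xlow ∈ cube d) {t : ℕ} (ht : t ≤ T) (i : Fin n) :
    Measurable (decision D xlow z sg t i) := by
  have h := (measurable_prepDecision hsg hz hDm hDK hl ht i).mono (ℱ.le t) le_rfl
  unfold decision
  exact (h.add_const xlow).const_smul (1 / 2 : ℝ)

/-- The reduction: the expected reward gap of learner `i` is controlled by the linear losses sent
to `D` and by the disagreement of the learners. -/
theorem reward_gap_le [IsProbabilityMeasure P] (hf : ∀ t < T, ∀ i, IsDRReward (f t i)) (hG : 0 ≤ G)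
    (hsg : IsStochasticGradient P ℱ T z f G sg)
    (hz : IsBoostingSample P ℱ T z) (hDm : ∀ t, Measurable (D t))
    (hDK : ∀ t c i, D t c i ∈ cube d) (hl : xlow ∈ cube d)
    (hcausal : ∀ t c c', (∀ s < t, c s = c' s) → D t c = D t c') (i : Fin n) {y : Vec d}
    (hy : y ∈ cube d) {B : ℝ}
    (hB : ∀ ω, ∑ t ∈ Finset.range T, ∑ j, (⟪sentLosses D xlow z sg ω T t j,
        D t (sentLosses D xlow z sg ω T) j - y⟫
        + G / 2 * ‖D t (sentLosses D xlow z sg ω T) i - D t (sentLosses D xlow z sg ω T) j‖)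
      ≤ B) :
    (1 - supNorm xlow) / 4 * ∑ t ∈ Finset.range T, ∑ j, f t j y
      - ∑ t ∈ Finset.range T, ∑ j, ∫ ω, f t j (decision D xlow z sg t i ω) ∂P ≤ B := by
  obtain ⟨M, hM0, hM⟩ := exists_norm_sub_le_of_mem_cube d
  set ψ : ℕ → Fin n → Ω → ℝ := fun t j ω =>
    ⟪sentLosses D xlow z sg ω T t j, prepDecision D xlow z sg t j ω - y⟫
      + G / 2 * ‖prepDecision D xlow z sg t i ω - prepDecision D xlow z sg t j ω‖ with hψ
  have hcm : ∀ t j, Measurable fun ω => sentLosses D xlow z sg ω T t j := fun t j =>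
    measurable_losses_iff.1
      ((measurable_sentLosses hsg hz hDm hDK hl le_rfl).mono (ℱ.le T) le_rfl) t j
  have hpm : ∀ t < T, ∀ j, Measurable (prepDecision D xlow z sg t j) := fun t ht j =>
    (measurable_prepDecision hsg hz hDm hDK hl ht.le j).mono (ℱ.le t) le_rfl
  have hint1 : ∀ t < T, ∀ j, Integrable (fun ω =>
      ⟪sentLosses D xlow z sg ω T t j, prepDecision D xlow z sg t j ω - y⟫) P := by
    intro t ht j
    refine Integrable.of_bound
      ((hcm t j).inner ((hpm t ht j).sub_const y)).aestronglyMeasurable (3 / 8 * G * M)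
      (ae_of_all _ fun ω => (norm_inner_le_norm _ _).trans ?_)
    exact mul_le_mul (norm_sentLosses_le hG hsg hz hDK hl ω t j) (hM _ (hDK _ _ _) _ hy)
      (norm_nonneg _) (by positivity)
  have hint2 : ∀ t < T, ∀ j, Integrable (fun ω =>
      G / 2 * ‖prepDecision D xlow z sg t i ω - prepDecision D xlow z sg t j ω‖) P := by
    intro t ht j
    refine (Integrable.of_bound ((hpm t ht i).sub (hpm t ht j)).norm.aestronglyMeasurable M
      (ae_of_all _ fun ω => ?_)).const_mul _
    rw [norm_norm]
    exact hM _ (hDK _ _ _) _ (hDK _ _ _)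
  have hintf : ∀ t < T, ∀ j k, Integrable (fun ω => f t j (decision D xlow z sg t k ω)) P :=
    fun t ht j k => integrable_comp_of_mem_cube (hf t ht j).differentiableOn.continuousOn
      (measurable_decision hsg hz hDm hDK hl ht.le k) (decision_mem_cube hDK hl t k)
  have hterm : ∀ t < T, ∀ j, (1 - supNorm xlow) / 4 * f t j y
      - ∫ ω, f t j (decision D xlow z sg t i ω) ∂P ≤ ∫ ω, ψ t j ω ∂P := by
    intro t ht j
    have hgrad : ∀ x ∈ cube d, ‖gradientWithin (f t j) (cube d) x‖ ≤ G := fun x hx =>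
      hsg.norm_gradientWithin_le hz ht j hx
    have hprep := measurable_prepDecision hsg hz hDm hDK hl ht.le j
    have hqm := queryPoint_prepDecision_measurable hprep
    have hqc : ∀ ω, queryPoint xlow (z t j ω) (prepDecision D xlow z sg t j ω) ∈ cube d :=
      fun ω => queryPoint_mem convex_cube hl (hDK _ _ _) (hz.mem t ht j ω)
    have h1 := (hf t ht j).le_integral_inner_of_condExp hgrad hl hy (hz.queryInfo_le ht j)
      (le_sup_left : ℱ t ≤ queryInfo ℱ z t j) hprep (fun ω => hDK _ _ _)
      ((comap_measurable (z t j)).mono le_sup_right le_rfl) (hz.mem t ht j) (hz.law t ht j)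
      (hz.indep t ht j)
      ((hsg.measurable t ht j _ hqm hqc).mono (ℱ.le _) le_rfl)
      (fun ω => hsg.bounded t ht j _ (hqc ω) ω) (hsg.unbiased t ht j _ hqm hqc)
    -- The price of evaluating `f t j` at learner `i`'s decision; the factor `1/2` comes from
    -- averaging with `xlow`.
    have h2 : ∫ ω, f t j (decision D xlow z sg t j ω) ∂P
        - ∫ ω, f t j (decision D xlow z sg t i ω) ∂P
        ≤ ∫ ω, G / 2 * ‖prepDecision D xlow z sg t i ω - prepDecision D xlow z sg t j ω‖ ∂P := by
      rw [← integral_sub (hintf t ht j j) (hintf t ht j i)]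
      refine integral_mono ((hintf t ht j j).sub (hintf t ht j i)) (hint2 t ht j) fun ω => ?_
      refine (norm_sub_le_of_norm_gradientWithin_le (hf t ht j).differentiableOn hgrad
        (decision_mem_cube hDK hl t i ω) (decision_mem_cube hDK hl t j ω)).trans (le_of_eq ?_)
      have e : decision D xlow z sg t j ω - decision D xlow z sg t i ω
        = (1 / 2 : ℝ) • (prepDecision D xlow z sg t j ω - prepDecision D xlow z sg t i ω) := by
        unfold decision; module
      rw [e, norm_smul, Real.norm_of_nonneg (by norm_num), norm_sub_rev]
      ring
    have h3 : ∫ ω, ψ t j ω ∂P = ∫ ω, ⟪sentLosses D xlow z sg ω T t j,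
        prepDecision D xlow z sg t j ω - y⟫ ∂P
        + ∫ ω, G / 2 * ‖prepDecision D xlow z sg t i ω - prepDecision D xlow z sg t j ω‖ ∂P :=
      integral_add (hint1 t ht j) (hint2 t ht j)
    rw [h3]
    simp only [sentLosses_of_lt D xlow z sg _ ht]
    change _ - ∫ ω, f t j (decision D xlow z sg t j ω) ∂P ≤ _ at h1
    linarith
  have hψint : ∀ t < T, ∀ j, Integrable (ψ t j) P := fun t ht j =>
    (hint1 t ht j).add (hint2 t ht j)
  rw [Finset.mul_sum, ← Finset.sum_sub_distrib]
  simp only [Finset.mul_sum, ← Finset.sum_sub_distrib]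
  calc _ ≤ ∑ t ∈ Finset.range T, ∑ j, ∫ ω, ψ t j ω ∂P :=
        Finset.sum_le_sum fun t ht => Finset.sum_le_sum fun j _ =>
          hterm t (Finset.mem_range.1 ht) j
    _ = ∫ ω, ∑ t ∈ Finset.range T, ∑ j, ψ t j ω ∂P := by
        rw [integral_finsetSum _ fun t ht => integrable_finsetSum _ fun j _ =>
          hψint t (Finset.mem_range.1 ht) j]
        refine Finset.sum_congr rfl fun t ht => ?_
        rw [integral_finsetSum _ fun j _ => hψint t (Finset.mem_range.1 ht) j]
    _ ≤ ∫ _ω, B ∂P := by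
        refine integral_mono (integrable_finsetSum _ fun t ht => integrable_finsetSum _ fun j _ =>
          hψint t (Finset.mem_range.1 ht) j) (integrable_const _) fun ω => ?_
        refine le_trans (le_of_eq ?_) (hB ω)
        refine Finset.sum_congr rfl fun t ht => Finset.sum_congr rfl fun j _ => ?_
        simp only [hψ, prepDecision_eq D xlow z sg ω hcausal (Finset.mem_range.1 ht).le]
    _ = B := by simp

end Run

end DOCSM

end

/-! ### Expected regret -/

theorem corollary2 {d n : ℕ} (T : ℕ)
    -- decision set and reward functions
    (K : Set (DOCSM.Vec d)) (R : ℝ) (hK : DOCSM.IsDecisionSet K R)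
    (f : ℕ → Fin n → DOCSM.Vec d → ℝ) (hf : ∀ t < T, ∀ i, DOCSM.IsDRReward (f t i))
    -- boosting samples and stochastic gradients
    {Ω : Type*} [mΩ : MeasurableSpace Ω] (P : Measure Ω) [IsProbabilityMeasure P]
    (ℱ : Filtration ℕ mΩ) (z : ℕ → Fin n → Ω → ℝ) (hz : DOCSM.IsBoostingSample P ℱ T z)
    (G : ℝ) (sg : ℕ → Fin n → DOCSM.Vec d → Ω → DOCSM.Vec d)
    (hsg : DOCSM.IsStochasticGradient P ℱ T z f G sg)
    -- communication network
    (𝒢 : SimpleGraph (Fin n)) (A : Matrix (Fin n) (Fin n) ℝ) (hA : DOCSM.IsCommMatrix 𝒢 A)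
    -- the point of smallest sup norm, the initial decision, the linear optimization oracle
    (xlow : DOCSM.Vec d) (hxlow : DOCSM.IsArgmin DOCSM.supNorm K xlow)
    (x₀ : DOCSM.Vec d) (hx₀ : DOCSM.IsArgmin (fun x => ‖x‖) K x₀)
    (lo : DOCSM.Vec d → DOCSM.Vec d) (hlo : DOCSM.IsLinearOracle K lo) (hlo_meas : Measurable lo)
    -- the number of gossip steps per block, and the learner
    (N : ℕ) (hCN : DOCSM.commC A ≤ N) (hNL : N ≤ max ⌈√(T : ℝ)⌉₊ (DOCSM.commC A))
    (i : Fin n) :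
    let D : DOCSM.DOCOAlg d n := (DOCSM.tunedParams A T G R N lo x₀).alg
    let α : ℝ := (1 - DOCSM.supNorm xlow) / 4
    let reg : Ω → ℝ := fun ω =>
      DOCSM.regret K f T α (fun t => DOCSM.decision D xlow z sg t i ω)
    let bound : ℝ := 2 * n * G * R * √(6 * T * DOCSM.commC A)
      + (4 * √3 + 13) * n * G * R * (T : ℝ) ^ (3 / 4 : ℝ)
    Integrable reg P ∧ ∫ ω, reg ω ∂P ≤ bound ∧
      bound ≤ 40 * (G * R) * (n * (T : ℝ) ^ (3 / 4 : ℝ)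
        + n * DOCSM.gap A ^ (-(1 / 4) : ℝ) * √(T * Real.log n)) := by
  intro D α reg bound
  have hn : 0 < n := i.pos
  -- Without rounds, nothing forces `G ≥ 0`; for `T > 0` it follows from the gradient bound.
  rcases Nat.eq_zero_or_pos T with rfl | hT
  · have hreg : reg = fun _ => 0 := by
      funext ω
      have : K.Nonempty := ⟨x₀, hx₀.1⟩
      simp [reg, DOCSM.regret, this]
    have hbound : bound = 0 := by simp [bound]
    rw [hreg, hbound]
    simp
  have hl : xlow ∈ DOCSM.cube d := hK.subset_cube hxlow.1
  have hG : 0 ≤ G := (norm_nonneg _).trans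
    (hsg.norm_gradientWithin_le hz hT i DOCSM.zero_mem_cube)
  have hR : 0 ≤ R := (norm_nonneg _).trans (hK.norm_le x₀ hx₀.1)
  have hDm : ∀ t, Measurable (D t) := fun t => DOCSM.ADFTRLParams.measurable_alg _ hlo_meas t
  have hDK : ∀ t c j, D t c j ∈ DOCSM.cube d := fun t c j => hK.subset_cube
    (DOCSM.ADFTRLParams.primal_mem hK.convex hlo hx₀.1 _ _)
  have hcausal : ∀ t c c', (∀ s < t, c s = c' s) → D t c = D t c' := fun t c c' h =>
    DOCSM.ADFTRLParams.alg_congr _ h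
  have hintf : ∀ t < T, ∀ j, Integrable
      (fun ω => f t j (DOCSM.decision D xlow z sg t i ω)) P := fun t ht j =>
    DOCSM.integrable_comp_of_mem_cube (hf t ht j).differentiableOn.continuousOn
      (DOCSM.measurable_decision hsg hz hDm hDK hl ht.le i) (DOCSM.decision_mem_cube hDK hl t i)
  have hintsum : Integrable (fun ω => ∑ t ∈ Finset.range T, ∑ j,
      f t j (DOCSM.decision D xlow z sg t i ω)) P :=
    integrable_finsetSum _ fun t ht => integrable_finsetSum _ fun j _ =>
      hintf t (Finset.mem_range.1 ht) j
  refine ⟨(integrable_const _).sub hintsum, ?_,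
    DOCSM.bound_le_rate hA hn T (mul_nonneg hG hR)⟩
  have hint : ∫ ω, reg ω ∂P
      = α * sSup ((fun y => ∑ t ∈ Finset.range T, ∑ j, f t j y) '' K)
        - ∑ t ∈ Finset.range T, ∑ j, ∫ ω, f t j (DOCSM.decision D xlow z sg t i ω) ∂P := by
    change ∫ ω, (_ - _) ∂P = _
    rw [integral_sub (integrable_const _) hintsum, integral_const, probReal_univ, one_smul,
      integral_finsetSum _ fun t ht => integrable_finsetSum _ fun j _ =>
        hintf t (Finset.mem_range.1 ht) j]
    congr 1
    refine Finset.sum_congr rfl fun t ht => ?_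
    rw [integral_finsetSum _ fun j _ => hintf t (Finset.mem_range.1 ht) j]
  have hgap : ∀ y ∈ K, α * ∑ t ∈ Finset.range T, ∑ j, f t j y
      - ∑ t ∈ Finset.range T, ∑ j, ∫ ω, f t j (DOCSM.decision D xlow z sg t i ω) ∂P
      ≤ bound := fun y hy =>
    DOCSM.reward_gap_le hf hG hsg hz hDm hDK hl hcausal i (hK.subset_cube hy) fun ω =>
      DOCSM.tuned_linear_regret_le hK hR hG hA hn hCN hlo hx₀
        (DOCSM.norm_sentLosses_le hG hsg hz hDK hl ω)
        (fun t ht => DOCSM.sentLosses_of_le D xlow z sg ω ht) i hy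
  rw [hint, sub_le_iff_le_add]
  have hα : 0 ≤ α := by
    have := DOCSM.supNorm_le_one hl
    simp only [α]
    linarith
  -- The supremum need not be attained in `K`. For `α > 0` the bounds for all `y` are divided by `α`
  -- and passed to the supremum; for `α = 0` the comparator term vanishes and any one point
  -- suffices.
  rcases hα.eq_or_lt with h0 | hα
  · have := hgap x₀ hx₀.1
    rw [← h0] at this ⊢
    linarith
  · rw [mul_comm, ← le_div_iff₀ hα]
    refine csSup_le (Set.Nonempty.image _ ⟨x₀, hx₀.1⟩) ?_
    rintro _ ⟨y, hy, rfl⟩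
    rw [le_div_iff₀ hα, mul_comm]
    linarith [hgap y hy]
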